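/- **Diffieties and flatness.** A diffiety with coordinates indexed by a countable set $I$ is an open subset $V\subset\mathbb R^{I}$ (product topology) with a vector field $\delta=\sum_{i\in I} c_i\,\partial_{x_i}$. The ring $\mathcal O(V)$ consists of the $C^\infty$ functions of finitely many coordinates, and the $c_i$ belong to it. A morphism $\phi:V_1\to V_2$ is a smooth map with $\phi^*\circ\delta_2=\delta_1\circ\phi^*$ on $\mathcal O(V_2)$; a diffeomorphism is a morphism with an inverse morphism. The jet space $\mathbf J(\mathbb R,\mathbb R^m)$ has coordinates $t,u_j^{(k)}$ ($1\le j\le m$, $k\in\mathbb N$) and derivation $\mathrm d_t=\partial_t+\sum_{j,k}u_j^{(k+1)}\partial_{u_j^{(k)}}$. A point $\eta\in V$ is *flat* if for some $m$ it has an open neighbourhood $O$ diffeomorphic, by some $\phi$, to an open subset of $\mathbf J(\mathbb R,\mathbb R^m)$. Functions $z_1,\dots,z_m$ are a *regular flat output at $\eta$* if such a $\phi$ exists with $\phi^*u_j=z_j$ on $O$ for all $j$. A control system $x'=f(t,x,u)$, with $f$ smooth on an open set $U$, defines the diffiety with coordinates $t,x_i,u_j^{(k)}$, where $(t,x,u)\in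 U$, and derivation $\mathrm d_t=\partial_t+\sum_i f_i\partial_{x_i}+\sum_{j,k}u_j^{(k+1)}\partial_{u_j^{(k)}}$. **The simplified aircraft.** The states are $x,y,z,V,\gamma,\chi,\alpha,\beta,\mu,p,q,r$. The controls are the thrust $F$, the deflections $\delta_\ell,\delta_m$, and a third control $w$, which is either $w=\delta_n$ (then the differential thrust ratio $\eta_T=(F_1-F_2)/(F_1+F_2)$ is a constant) or $w=\eta_T$ (then $\delta_n$ is a constant). Let $m>0$, $g,S,a,b,y_p,\epsilon$ be real constants, let $J=\begin{pmatrix}I_{xx}&0&-I_{xz}\\0&I_{yy}&0\\-I_{xz}&0&I_{zz}\end{pmatrix}$ be invertible, and let $\rho=\rho(z)$ be smooth. Let $C_x,C_y,C_z,C_l,C_m,C_n$ be smooth functions of $(z,\alpha,\beta,p,q,r,\delta_\ell,\delta_m,\delta_n)$. In $C_x,C_y,C_z$ the variables $p,q,r,\delta_\ell,\delta_m,\delta_n$ are replaced by fixed constants. Put $D=\frac{\rho}{2}SV^2$ and $$\begin{aligned}X&=F\cos(\alpha+\epsilon)\cos\beta-D\,C_x-gm\sin\gamma,\\ Y&=F\cos(\alpha+\epsilon)\sin\beta+D\,C_y+gm\cos\gamma\sin\mu,\\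 Z&=-F\sin(\alpha+\epsilon)-D\,C_z+gm\cos\gamma\cos\mu,\\ L&=-y_p\sin(\epsilon)\,\eta_TF+D\,a\,C_l,\qquad M=D\,b\,C_m,\qquad N=y_p\cos(\epsilon)\,\eta_TF+D\,a\,C_n.\end{aligned}$$ On the open set $\cos\beta\cos\gamma\,V\ne0$ the equations are $$\begin{aligned}x'&=V\cos\chi\cos\gamma,\quad y'=V\sin\chi\cos\gamma,\quad z'=-V\sin\gamma,\\ V'&=\tfrac Xm,\quad \gamma'=-\tfrac{Y\sin\mu+Z\cos\mu}{mV},\quad \chi'=\tfrac{Y\cos\mu-Z\sin\mu}{\cos\gamma\, mV},\\ \alpha'&=\tfrac1{\cos\beta}\left(-p\cos\alpha\sin\beta+q\cos\beta-r\sin\alpha\sin\beta+\tfrac Z{mV}\right),\\ \beta'&=p\sin\alpha-r\cos\alpha+\tfrac Y{mV},\\ \mu'&=\tfrac1{\cos\beta}\left(p\cos\alpha+r\sin\alpha+\tfrac1{mV}\big(Y\cos\mu\tan\gamma\cos\beta-Z(\sin\mu\tan\gamma\cos\beta+\sin\beta)\big)\right),\\ \begin{pmatrix}p'\\q'\\r'\end{pmatrix}&=J^{-1}\begin{pmatrix}(I_{yy}-I_{zz})qr+I_{xz}pq+L\\(I_{zz}-I_{xx})pr+I_{xz}(r^2-p^2)+M\\(I_{xx}-I_{yy})pq-I_{xz}rq+N\end{pmatrix}.\end{aligned}$$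 Let $\Delta$ be the $3\times4$ Jacobian matrix of $X$, $\sin(\mu)Y+\cos(\mu)Z$, $-\cos(\mu)Y+\sin(\mu)Z$ with respect to $\alpha,\beta,\mu,F$. For $\xi\in\{\alpha,\beta,\mu,F\}$ let $\Delta_\xi$ be $\Delta$ with the column of $\xi$ deleted. **Proposition.** Let $\eta$ be a point of the diffiety of the simplified aircraft (so $\cos\beta\cos\gamma\,V\neq0$ at $\eta$) at which the Jacobian determinant of $(L,M,N)$ with respect to $(\delta_\ell,\delta_m,w)$ does not vanish. 1. If $\Delta$ has rank $3$ at $\eta$, then $\eta$ is a flat point. 2. For every $\xi\in\{\alpha,\beta,\mu,F\}$, if $|\Delta_\xi|\neq0$ at $\eta$, then $x,y,z,\xi$ is a regular flat output at $\eta$. -/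

import Mathlib

open scoped ContDiff Matrix

noncomputable section

/-! ## Diffieties

All diffieties needed here carry global coordinates: they are open subsets of `ℝ^ι`, with `ι`
countable, for the product topology (the coarsest one making the coordinates continuous). -/

/-- `f` belongs to the ring `𝒪(O)` of smooth functions on the open set `O ⊆ ℝ^ι`: on `O` it is a
`C^∞` function of finitely many coordinates. -/
def SmoothFunOn {ι : Type*} (f : (ι → ℝ) → ℝ) (O : Set (ι → ℝ)) : Prop :=
  ∃ (s : Finset ι) (h : (s → ℝ) → ℝ),
    ContDiffOn ℝ ∞ h (s.restrict '' O) ∧ ∀ p ∈ O, f p = h (s.restrict p)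

/-- A diffiety with global coordinates indexed by the countable set `ι`: an open subset of `ℝ^ι`
together with a smooth vector field `cartan`, which stands for `∑ i, cartan i ∂/∂x_i`. -/
structure Diffiety (ι : Type) [Countable ι] where
  carrier : Set (ι → ℝ)
  isOpen_carrier : IsOpen carrier
  cartan : (ι → ℝ) → ι → ℝ
  smooth_cartan : ∀ i, SmoothFunOn (fun p => cartan p i) carrier

theorem SmoothFunOn.mono {ι : Type*} {f : (ι → ℝ) → ℝ} {O O' : Set (ι → ℝ)}
    (h : SmoothFunOn f O) (hO : O' ⊆ O) : SmoothFunOn f O' := by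
  obtain ⟨s, k, hk, hf⟩ := h
  exact ⟨s, k, hk.mono (Set.image_mono hO), fun p hp => hf p (hO hp)⟩

namespace Diffiety

variable {ι ι' : Type} [Countable ι] [Countable ι']

/-- The Cartan derivation acting on functions: the derivative along the vector field `cartan`. -/
def derivation (D : Diffiety ι) (f : (ι → ℝ) → ℝ) (p : ι → ℝ) : ℝ :=
  lineDeriv ℝ f p (D.cartan p)

/-- The open subdiffiety cut out by an open set `O`. -/
def restrict (D : Diffiety ι) (O : Set (ι → ℝ)) (hO : IsOpen O) : Diffiety ι where
  carrier := D.carrier ∩ O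
  isOpen_carrier := D.isOpen_carrier.inter hO
  cartan := D.cartan
  smooth_cartan i := (D.smooth_cartan i).mono Set.inter_subset_left

/-- Morphisms of diffieties (Lie-Bäcklund transforms): smooth maps `φ` such that
`φ^* ∘ δ₂ = δ₁ ∘ φ^*` on the ring of smooth functions. -/
structure IsMorphism (D₁ : Diffiety ι) (D₂ : Diffiety ι') (φ : (ι → ℝ) → (ι' → ℝ)) : Prop where
  mapsTo : Set.MapsTo φ D₁.carrier D₂.carrier
  smooth : ∀ f, SmoothFunOn f D₂.carrier → SmoothFunOn (f ∘ φ) D₁.carrier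
  derivation_comp : ∀ f, SmoothFunOn f D₂.carrier → ∀ p ∈ D₁.carrier,
    D₁.derivation (f ∘ φ) p = D₂.derivation f (φ p)

/-- `φ` is a diffeomorphism of diffieties from `D₁` onto `D₂`. -/
def IsDiffeo (D₁ : Diffiety ι) (D₂ : Diffiety ι') (φ : (ι → ℝ) → (ι' → ℝ)) : Prop :=
  D₁.IsMorphism D₂ φ ∧ ∃ ψ : (ι' → ℝ) → (ι → ℝ), D₂.IsMorphism D₁ ψ ∧
    (∀ p ∈ D₁.carrier, ψ (φ p) = p) ∧ ∀ w ∈ D₂.carrier, φ (ψ w) = w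

end Diffiety

/-! ## Jet space and flatness -/

/-- Coordinates of `J(ℝ, ℝ^m)`: `none` is the time `t` and `some (j, k)` is `u_j^{(k)}`. -/
abbrev JetCoord (m : ℕ) : Type := Option (Fin m × ℕ)

/-- The jet space `J(ℝ, ℝ^m)` with `d_t = ∂_t + ∑ u_j^{(k+1)} ∂/∂u_j^{(k)}`. -/
def jetSpace (m : ℕ) : Diffiety (JetCoord m) where
  carrier := Set.univ
  isOpen_carrier := isOpen_univ
  cartan p
    | none => 1
    | some (j, k) => p (some (j, k + 1))
  smooth_cartan i := by
    rcases i with _ | ⟨j, k⟩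
    · exact ⟨∅, fun _ => 1, contDiffOn_const, fun _ _ => rfl⟩
    · exact ⟨{some (j, k + 1)}, fun y => y ⟨some (j, k + 1), Finset.mem_singleton_self _⟩,
        (contDiff_apply ℝ ℝ _).contDiffOn, fun _ _ => rfl⟩

namespace Diffiety

variable {ι : Type} [Countable ι]

/-- `φ` identifies the neighbourhood `O` of `η` in `D` with an open subset of `J(ℝ, ℝ^m)`. -/
def IsFlatChartAt (D : Diffiety ι) (η : ι → ℝ) (m : ℕ) (O : Set (ι → ℝ))
    (φ : (ι → ℝ) → (JetCoord m → ℝ)) : Prop :=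
  η ∈ D.carrier ∧ η ∈ O ∧ ∃ (hO : IsOpen O) (W : Set (JetCoord m → ℝ)) (hW : IsOpen W),
    (D.restrict O hO).IsDiffeo ((jetSpace m).restrict W hW) φ

/-- `η` is a flat point of `D`. -/
def IsFlatPoint (D : Diffiety ι) (η : ι → ℝ) : Prop :=
  ∃ (m : ℕ) (O : Set (ι → ℝ)) (φ : (ι → ℝ) → (JetCoord m → ℝ)), D.IsFlatChartAt η m O φ

/-- `z = (z_1, …, z_m)` is a flat output of `D` which is regular at `η`: `η` is in the domain of a
local diffeomorphism `φ` to the jet space with `φ^* u_j = z_j` for all `j`. -/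
def IsRegularFlatOutputAt (D : Diffiety ι) {m : ℕ} (z : Fin m → (ι → ℝ) → ℝ) (η : ι → ℝ) : Prop :=
  ∃ (O : Set (ι → ℝ)) (φ : (ι → ℝ) → (JetCoord m → ℝ)), D.IsFlatChartAt η m O φ ∧
    ∀ p ∈ D.carrier ∩ O, ∀ j, φ p (some (j, 0)) = z j p

end Diffiety

/-! ## Control systems `x_i' = f_i(t, x, u)` -/

/-- A control system with states indexed by `σ` and controls indexed by `κ`. A point of
`σ ⊕ κ → ℝ` is a pair (states, controls). -/
structure ControlSystem (σ κ : Type) [Fintype σ] [Fintype κ] where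
  dom : Set (ℝ × (σ ⊕ κ → ℝ))
  isOpen_dom : IsOpen dom
  f : ℝ × (σ ⊕ κ → ℝ) → σ → ℝ
  smooth_f : ∀ i, ContDiffOn ℝ ∞ (fun q => f q i) dom

/-- Coordinates of the diffiety of a control system: `none` is the time, `some (inl i)` is the
state `x_i`, and `some (inr (j, k))` is the derivative `u_j^{(k)}` of a control. -/
abbrev SystemCoord (σ κ : Type) : Type := Option (σ ⊕ κ × ℕ)

/-- The coordinate of the diffiety attached to a state or (undifferentiated) control variable. -/
def SystemCoord.ofVar {σ κ : Type} : σ ⊕ κ → SystemCoord σ κ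
  | .inl i => some (.inl i)
  | .inr j => some (.inr (j, 0))

/-- The values of the states and controls at a point of the diffiety. -/
def SystemCoord.values {σ κ : Type} (η : SystemCoord σ κ → ℝ) : σ ⊕ κ → ℝ :=
  fun v => η (SystemCoord.ofVar v)

namespace ControlSystem

variable {σ κ : Type} [Fintype σ] [Fintype κ]

/-- The diffiety of a control system, with Cartan derivation
`d_t = ∂_t + ∑ f_i ∂/∂x_i + ∑ u_j^{(k+1)} ∂/∂u_j^{(k)}`. -/
def diffiety (Sys : ControlSystem σ κ) : Diffiety (SystemCoord σ κ) where
  carrier := {η | (η none, SystemCoord.values η) ∈ Sys.dom}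
  isOpen_carrier := Sys.isOpen_dom.preimage <|
    (continuous_apply none).prodMk (continuous_pi fun _ => continuous_apply _)
  cartan η
    | none => 1
    | some (.inl i) => Sys.f (η none, SystemCoord.values η) i
    | some (.inr (j, k)) => η (some (.inr (j, k + 1)))
  smooth_cartan c := by
    classical
    rcases c with _ | i | ⟨j, k⟩
    · exact ⟨∅, fun _ => 1, contDiffOn_const, fun _ _ => rfl⟩
    · let s : Finset (SystemCoord σ κ) :=
        insert none (Finset.univ.image (SystemCoord.ofVar (σ := σ) (κ := κ)))
      have h0 : none ∈ s := Finset.mem_insert_self _ _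
      have hv : ∀ v, SystemCoord.ofVar v ∈ s := fun v =>
        Finset.mem_insert_of_mem (Finset.mem_image_of_mem _ (Finset.mem_univ v))
      let e : (s → ℝ) → ℝ × (σ ⊕ κ → ℝ) := fun y => (y ⟨none, h0⟩, fun v => y ⟨_, hv v⟩)
      have he : ContDiff ℝ ∞ e :=
        (contDiff_apply ℝ ℝ _).prodMk (contDiff_pi.2 fun v => contDiff_apply ℝ ℝ _)
      refine ⟨s, fun y => Sys.f (e y) i, (Sys.smooth_f i).comp he.contDiffOn ?_, fun _ _ => rfl⟩
      rintro _ ⟨p, hp, rfl⟩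
      exact hp
    · exact ⟨{some (.inr (j, k + 1))},
        fun y => y ⟨some (.inr (j, k + 1)), Finset.mem_singleton_self _⟩,
        (contDiff_apply ℝ ℝ _).contDiffOn, fun _ _ => rfl⟩

end ControlSystem

/-- The partial derivative `∂f/∂ξ` at `q`. -/
def partialDeriv {ν : Type} [DecidableEq ν] (f : (ν → ℝ) → ℝ) (ξ : ν) (q : ν → ℝ) : ℝ :=
  deriv (fun s => f (Function.update q ξ s)) (q ξ)

/-! ## The aircraft -/

namespace Aircraft

/-- State variables: position, speed, path angle, heading, angle of attack, sideslip angle, bank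
angle, roll, pitch and yaw rates. -/
inductive State
  | x | y | z | V | γ | χ | α | β | μ | p | q | r
  deriving DecidableEq

instance : Fintype State :=
  ⟨{.x, .y, .z, .V, .γ, .χ, .α, .β, .μ, .p, .q, .r}, fun s => by cases s <;> simp⟩

/-- Control variables: thrust, ailerons, elevator, and the yaw control, which is either the rudder
deflection or the differential thrust ratio. -/
inductive Control
  | F | δl | δm | yaw
  deriving DecidableEq

instance : Fintype Control :=
  ⟨{.F, .δl, .δm, .yaw}, fun s => by cases s <;> simp⟩

/-- The two possible choices for the yaw control. -/
inductive YawControl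
  | rudder | differentialThrust

/-- Arguments of the aerodynamic coefficients. -/
inductive AeroVar
  | z | α | β | p | q | r | δl | δm | δn
  deriving DecidableEq

instance : Fintype AeroVar :=
  ⟨{.z, .α, .β, .p, .q, .r, .δl, .δm, .δn}, fun s => by cases s <;> simp⟩

/-- States and controls of the aircraft. -/
abbrev Point : Type := State ⊕ Control → ℝ

/-- The data of an aircraft model. -/
structure Model where
  /-- mass, gravity, wing area, wing span, mean aerodynamic chord -/
  (m g S a b : ℝ)
  /-- distance of the engines to the plane of symmetry, and their inclination -/
  (y_p ε : ℝ)
  /-- entries of the tensor of inertia -/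
  (Ixx Iyy Izz Ixz : ℝ)
  /-- air density, which may depend on the altitude -/
  ρ : ℝ → ℝ
  /-- aerodynamic coefficients of the full model -/
  (Cx Cy Cz Cl Cm Cn : (AeroVar → ℝ) → ℝ)
  /-- constants that replace `p, q, r, δl, δm, δn` in `Cx, Cy, Cz` in the simplified model -/
  (p₀ q₀ r₀ δl₀ δm₀ δn₀ : ℝ)
  /-- which variable is used as yaw control -/
  yawControl : YawControl
  /-- the constant rudder deflection when the differential thrust is used as control -/
  δn_fixed : ℝ
  /-- the constant differential thrust ratio when the rudder is used as control -/
  η_fixed : ℝ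
  m_pos : 0 < m
  inertia_ne : (!![Ixx, 0, -Ixz; 0, Iyy, 0; -Ixz, 0, Izz] : Matrix (Fin 3) (Fin 3) ℝ).det ≠ 0
  smooth_ρ : ContDiff ℝ ∞ ρ
  smooth_Cx : ContDiff ℝ ∞ Cx
  smooth_Cy : ContDiff ℝ ∞ Cy
  smooth_Cz : ContDiff ℝ ∞ Cz
  smooth_Cl : ContDiff ℝ ∞ Cl
  smooth_Cm : ContDiff ℝ ∞ Cm
  smooth_Cn : ContDiff ℝ ∞ Cn

namespace Model

variable (A : Model)

/-- The tensor of inertia. -/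
def J : Matrix (Fin 3) (Fin 3) ℝ :=
  !![A.Ixx, 0, -A.Ixz; 0, A.Iyy, 0; -A.Ixz, 0, A.Izz]

/-- The rudder deflection `δn`. -/
def rudder (v : Point) : ℝ :=
  match A.yawControl with
  | .rudder => v (.inr .yaw)
  | .differentialThrust => A.δn_fixed

/-- The differential thrust ratio `η = (F₁ - F₂) / (F₁ + F₂)`. -/
def thrustRatio (v : Point) : ℝ :=
  match A.yawControl with
  | .rudder => A.η_fixed
  | .differentialThrust => v (.inr .yaw)

/-- The actual arguments of the aerodynamic coefficients. -/
def aeroArgs (v : Point) : AeroVar → ℝ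
  | .z => v (.inl .z)
  | .α => v (.inl .α)
  | .β => v (.inl .β)
  | .p => v (.inl .p)
  | .q => v (.inl .q)
  | .r => v (.inl .r)
  | .δl => v (.inr .δl)
  | .δm => v (.inr .δm)
  | .δn => A.rudder v

/-- The simplified arguments: `p, q, r, δl, δm, δn` are replaced by known constants. -/
def simplifiedArgs (v : Point) : AeroVar → ℝ
  | .z => v (.inl .z)
  | .α => v (.inl .α)
  | .β => v (.inl .β)
  | .p => A.p₀
  | .q => A.q₀
  | .r => A.r₀
  | .δl => A.δl₀
  | .δm => A.δm₀
  | .δn => A.δn₀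

/-- `(ρ / 2) S V²`. -/
def dynamicForce (v : Point) : ℝ :=
  A.ρ (v (.inl .z)) / 2 * A.S * v (.inl .V) ^ 2

/-- The force `X` of the simplified model (wind frame, gravity included). -/
def X (v : Point) : ℝ :=
  v (.inr .F) * Real.cos (v (.inl .α) + A.ε) * Real.cos (v (.inl .β))
    - A.dynamicForce v * A.Cx (A.simplifiedArgs v) - A.g * A.m * Real.sin (v (.inl .γ))

/-- The force `Y` of the simplified model. -/
def Y (v : Point) : ℝ :=
  v (.inr .F) * Real.cos (v (.inl .α) + A.ε) * Real.sin (v (.inl .β))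
    + A.dynamicForce v * A.Cy (A.simplifiedArgs v)
    + A.g * A.m * Real.cos (v (.inl .γ)) * Real.sin (v (.inl .μ))

/-- The force `Z` of the simplified model. -/
def Z (v : Point) : ℝ :=
  -v (.inr .F) * Real.sin (v (.inl .α) + A.ε)
    - A.dynamicForce v * A.Cz (A.simplifiedArgs v)
    + A.g * A.m * Real.cos (v (.inl .γ)) * Real.cos (v (.inl .μ))

/-- The torques `(L, M, N)`, where `F₁ - F₂ = η F`. -/
def torque (v : Point) : Fin 3 → ℝ :=
  ![-A.y_p * Real.sin A.ε * (A.thrustRatio v * v (.inr .F))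
      + A.dynamicForce v * A.a * A.Cl (A.aeroArgs v),
    A.dynamicForce v * A.b * A.Cm (A.aeroArgs v),
    A.y_p * Real.cos A.ε * (A.thrustRatio v * v (.inr .F))
      + A.dynamicForce v * A.a * A.Cn (A.aeroArgs v)]

/-- The right-hand side of the equations of `(p', q', r')`. -/
def rotational (v : Point) : Fin 3 → ℝ :=
  let p := v (.inl .p)
  let q := v (.inl .q)
  let r := v (.inl .r)
  A.J⁻¹ *ᵥ
    (![(A.Iyy - A.Izz) * q * r + A.Ixz * p * q,
       (A.Izz - A.Ixx) * p * r + A.Ixz * (r ^ 2 - p ^ 2),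
       (A.Ixx - A.Iyy) * p * q - A.Ixz * r * q] + A.torque v)

/-- The right-hand side of the simplified aircraft equations. -/
def rhs (v : Point) : State → ℝ :=
  let V := v (.inl .V)
  let γ := v (.inl .γ)
  let χ := v (.inl .χ)
  let α := v (.inl .α)
  let β := v (.inl .β)
  let μ := v (.inl .μ)
  let p := v (.inl .p)
  let q := v (.inl .q)
  let r := v (.inl .r)
  let X := A.X v
  let Y := A.Y v
  let Z := A.Z v
  fun
  | .x => V * Real.cos χ * Real.cos γ
  | .y => V * Real.sin χ * Real.cos γ
  | .z => -V * Real.sin γ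
  | .V => X / A.m
  | .γ => -(Y * Real.sin μ + Z * Real.cos μ) / (A.m * V)
  | .χ => (Y * Real.cos μ - Z * Real.sin μ) / (Real.cos γ * A.m * V)
  | .α => 1 / Real.cos β * (-p * Real.cos α * Real.sin β + q * Real.cos β
      - r * Real.sin α * Real.sin β + Z / (A.m * V))
  | .β => p * Real.sin α - r * Real.cos α + Y / (A.m * V)
  | .μ => 1 / Real.cos β * (p * Real.cos α + r * Real.sin α
      + 1 / (A.m * V) * (Y * Real.cos μ * Real.tan γ * Real.cos β
        - Z * (Real.sin μ * Real.tan γ * Real.cos β + Real.sin β)))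
  | .p => A.rotational v 0
  | .q => A.rotational v 1
  | .r => A.rotational v 2

/-- The points where the equations make sense: `cos β cos γ V ≠ 0`. -/
def admissible : Set Point :=
  {v | Real.cos (v (.inl .β)) * Real.cos (v (.inl .γ)) * v (.inl .V) ≠ 0}

theorem contDiff_coord (i : State ⊕ Control) : ContDiff ℝ ∞ (fun v : Point => v i) :=
  contDiff_apply ℝ ℝ i

theorem contDiff_simplifiedArgs : ContDiff ℝ ∞ A.simplifiedArgs := by
  refine contDiff_pi.2 fun i => ?_
  cases i <;> simp only [simplifiedArgs] <;> first | exact contDiff_const | exact contDiff_coord _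

theorem contDiff_rudder : ContDiff ℝ ∞ A.rudder := by
  unfold rudder
  cases A.yawControl
  · exact contDiff_coord _
  · exact contDiff_const

theorem contDiff_thrustRatio : ContDiff ℝ ∞ A.thrustRatio := by
  unfold thrustRatio
  cases A.yawControl
  · exact contDiff_const
  · exact contDiff_coord _

theorem contDiff_aeroArgs : ContDiff ℝ ∞ A.aeroArgs := by
  refine contDiff_pi.2 fun i => ?_
  cases i <;> simp only [aeroArgs] <;> first | exact contDiff_coord _ | exact A.contDiff_rudder

theorem contDiff_dynamicForce : ContDiff ℝ ∞ A.dynamicForce := by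
  have h := A.smooth_ρ
  unfold dynamicForce
  fun_prop

theorem contDiff_X : ContDiff ℝ ∞ A.X := by
  have h := A.smooth_Cx.comp A.contDiff_simplifiedArgs
  have hd := A.contDiff_dynamicForce
  unfold Function.comp at h
  unfold X
  fun_prop

theorem contDiff_Y : ContDiff ℝ ∞ A.Y := by
  have h := A.smooth_Cy.comp A.contDiff_simplifiedArgs
  have hd := A.contDiff_dynamicForce
  unfold Function.comp at h
  unfold Y
  fun_prop

theorem contDiff_Z : ContDiff ℝ ∞ A.Z := by
  have h := A.smooth_Cz.comp A.contDiff_simplifiedArgs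
  have hd := A.contDiff_dynamicForce
  unfold Function.comp at h
  unfold Z
  fun_prop

theorem contDiff_torque (i : Fin 3) : ContDiff ℝ ∞ (fun v => A.torque v i) := by
  have hl := A.smooth_Cl.comp A.contDiff_aeroArgs
  have hm := A.smooth_Cm.comp A.contDiff_aeroArgs
  have hn := A.smooth_Cn.comp A.contDiff_aeroArgs
  have hd := A.contDiff_dynamicForce
  have ht := A.contDiff_thrustRatio
  unfold Function.comp at hl hm hn
  fin_cases i <;> simp [torque] <;> fun_prop

theorem contDiff_rotational (i : Fin 3) : ContDiff ℝ ∞ (fun v => A.rotational v i) := by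
  have h0 := A.contDiff_torque 0
  have h1 := A.contDiff_torque 1
  have h2 := A.contDiff_torque 2
  have h : (fun v => A.rotational v i) = fun v : Point =>
      A.J⁻¹ i 0 * ((A.Iyy - A.Izz) * v (.inl .q) * v (.inl .r)
          + A.Ixz * v (.inl .p) * v (.inl .q) + A.torque v 0)
        + A.J⁻¹ i 1 * ((A.Izz - A.Ixx) * v (.inl .p) * v (.inl .r)
          + A.Ixz * (v (.inl .r) ^ 2 - v (.inl .p) ^ 2) + A.torque v 1)
        + A.J⁻¹ i 2 * ((A.Ixx - A.Iyy) * v (.inl .p) * v (.inl .q)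
          - A.Ixz * v (.inl .r) * v (.inl .q) + A.torque v 2) := by
    funext v
    simp only [rotational, Matrix.mulVec, dotProduct, Fin.sum_univ_three, Pi.add_apply]
    rfl
  rw [h]
  fun_prop

theorem isOpen_admissible : IsOpen admissible :=
  isOpen_ne_fun (by fun_prop) continuous_const

theorem contDiffOn_rhs (i : State) : ContDiffOn ℝ ∞ (fun v => A.rhs v i) admissible := by
  intro v hv
  obtain ⟨⟨hβ, hγ⟩, hV⟩ : (Real.cos (v (.inl .β)) ≠ 0 ∧ Real.cos (v (.inl .γ)) ≠ 0) ∧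
      v (.inl .V) ≠ 0 := by simpa [admissible] using hv
  have hm := A.m_pos.ne'
  have hc := fun k => (contDiff_coord k).contDiffAt (x := v)
  have hX := A.contDiff_X.contDiffAt (x := v)
  have hY := A.contDiff_Y.contDiffAt (x := v)
  have hZ := A.contDiff_Z.contDiffAt (x := v)
  have hs := fun k => (hc k).sin
  have hk := fun k => (hc k).cos
  have hmV : ContDiffAt ℝ ∞ (fun w : Point => A.m * w (.inl .V)) v :=
    contDiffAt_const.mul (hc _)
  have hmV0 : A.m * v (.inl .V) ≠ 0 := mul_ne_zero hm hV
  have htan : ContDiffAt ℝ ∞ (fun w : Point => Real.tan (w (.inl .γ))) v :=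
    ContDiffAt.comp (g := Real.tan) v (Real.contDiffAt_tan.2 hγ) (hc (.inl .γ))
  have hβi : ContDiffAt ℝ ∞ (fun w : Point => 1 / Real.cos (w (.inl .β))) v :=
    contDiffAt_const.div (hk _) hβ
  have hmVi : ContDiffAt ℝ ∞ (fun w : Point => 1 / (A.m * w (.inl .V))) v :=
    contDiffAt_const.div hmV hmV0
  apply ContDiffAt.contDiffWithinAt
  cases i with
  | x => exact ((hc _).mul (hk _)).mul (hk _)
  | y => exact ((hc _).mul (hs _)).mul (hk _)
  | z => exact (hc _).neg.mul (hs _)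
  | V => exact hX.div contDiffAt_const hm
  | γ => exact ((hY.mul (hs _)).add (hZ.mul (hk _))).neg.div hmV hmV0
  | χ =>
    exact ((hY.mul (hk _)).sub (hZ.mul (hs _))).div (((hk _).mul contDiffAt_const).mul (hc _))
      (mul_ne_zero (mul_ne_zero hγ hm) hV)
  | α =>
    exact hβi.mul ((((((hc _).neg.mul (hk _)).mul (hs _)).add ((hc _).mul (hk _))).sub
      (((hc _).mul (hs _)).mul (hs _))).add (hZ.div hmV hmV0))
  | β => exact (((hc _).mul (hs _)).sub ((hc _).mul (hk _))).add (hY.div hmV hmV0)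
  | μ =>
    exact hβi.mul ((((hc _).mul (hk _)).add ((hc _).mul (hs _))).add
      (hmVi.mul ((((hY.mul (hk _)).mul htan).mul (hk _)).sub
        (hZ.mul ((((hs _).mul htan).mul (hk _)).add (hs _))))))
  | p => exact (A.contDiff_rotational 0).contDiffAt
  | q => exact (A.contDiff_rotational 1).contDiffAt
  | r => exact (A.contDiff_rotational 2).contDiffAt

/-- The simplified aircraft as a control system with 12 states and 4 controls. -/
def simplified : ControlSystem State Control where
  dom := Set.univ ×ˢ admissible
  isOpen_dom := isOpen_univ.prod isOpen_admissible
  f q := A.rhs q.2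
  smooth_f i := (A.contDiffOn_rhs i).comp contDiffOn_snd fun _ hq => hq.2

/-- The variables of `Ξ₂`. -/
def Xi2 : Fin 4 → State ⊕ Control :=
  ![.inl .α, .inl .β, .inl .μ, .inr .F]

/-- The three functions `X`, `sin(μ) Y + cos(μ) Z` and `-cos(μ) Y + sin(μ) Z`. -/
def Q : Fin 3 → Point → ℝ :=
  ![A.X,
    fun v => Real.sin (v (.inl .μ)) * A.Y v + Real.cos (v (.inl .μ)) * A.Z v,
    fun v => -Real.cos (v (.inl .μ)) * A.Y v + Real.sin (v (.inl .μ)) * A.Z v]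

/-- The Jacobian matrix `Δ` of these functions with respect to `α, β, μ, F`. -/
def Delta (v : Point) : Matrix (Fin 3) (Fin 4) ℝ :=
  Matrix.of fun i ξ => partialDeriv (A.Q i) (Xi2 ξ) v

/-- The matrix `Δ_ξ`: the column of `ξ` is suppressed. -/
def DeltaMinor (ξ : Fin 4) (v : Point) : Matrix (Fin 3) (Fin 3) ℝ :=
  (A.Delta v).submatrix id ξ.succAbove

/-- The Jacobian matrix of the torques `(L, M, N)` with respect to the controls other than the
thrust. -/
def controlEffectiveness (v : Point) : Matrix (Fin 3) (Fin 3) ℝ :=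
  Matrix.of fun i j => partialDeriv (fun w => A.torque w i)
    (.inr ((![.δl, .δm, .yaw] : Fin 3 → Control) j)) v

/-- The functions `x, y, z, ξ` on the diffiety. -/
def outputs (ξ : Fin 4) : Fin 4 → (SystemCoord State Control → ℝ) → ℝ :=
  fun j η => SystemCoord.values η
    ((![.inl .x, .inl .y, .inl .z, Xi2 ξ] : Fin 4 → State ⊕ Control) j)

end Model

end Aircraft

end

/-! The equations form a cascade that can be solved block by block. The velocities `x', y', z'`
determine `V, γ, χ`: this is a change to spherical coordinates, with Jacobian determinant `V² cos
γ`. The derivatives `V', γ', χ'` then give the values of the three functions `A.Q`. Knowing `ξ`, one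
solves for the other three of `α, β, μ, F`, and the relevant minor is `|Δ_ξ|`. Next, `α', β', μ'`
give equations linear in `p, q, r`, with determinant `-(mV)³ cos β cos γ`. Finally `p', q', r'` give
the torques, which are solved for `δ_ℓ, δ_m, w` by the hypothesis on `(L, M, N)`. The cascade exists
because the simplified forces involve neither the rates nor the deflections.

Each stage is an application of the inverse function theorem, packaged in
`PartialInverse.exists_extend` and `ControlSystem.exists_extend`. After four stages all states and
controls are smooth functions on an open set of the jet space of `x, y, z, ξ`. By construction these
functions satisfy the solved equations on that whole open set, not only at jets coming from the
system. By `eq_rhs_of_solves` they therefore satisfy the aircraft equations, and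
`isRegularFlatOutputAt_of_partialInverse` turns this into an inverse morphism.

Flatness for rank `3` follows because some maximal minor `Δ_ξ` is then nonzero. -/

open Set Filter Topology

noncomputable section

/-! ### Calculus of smooth functions of finitely many coordinates -/

namespace SmoothFunOn

variable {ι κ : Type*} {O : Set (ι → ℝ)} {f : (ι → ℝ) → ℝ}

theorem _root_.Finset.isOpen_restrict_image (s : Finset ι) (hO : IsOpen O) :
    IsOpen (s.restrict '' O : Set (s → ℝ)) := by
  classical
  rw [isOpen_iff_mem_nhds]
  rintro _ ⟨p, hp, rfl⟩
  -- A continuous section of the restriction through `p`: the coordinates outside `s` are frozen at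
  -- those of `p`, so the preimage of `O` is a neighbourhood contained in the image.
  let e : (s → ℝ) → ι → ℝ := fun y i => if h : i ∈ s then y ⟨i, h⟩ else p i
  have he : Continuous e := by
    refine continuous_pi fun i => ?_
    by_cases h : i ∈ s
    · simpa [e, h] using continuous_apply (⟨i, h⟩ : s)
    · simpa [e, h] using continuous_const
  have hep : e (s.restrict p) = p := by
    funext i
    by_cases h : i ∈ s <;> simp [e, h]
  refine mem_of_superset ((hO.preimage he).mem_nhds (by simpa [hep] using hp)) fun y hy => ?_
  refine ⟨e y, hy, ?_⟩
  funext i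
  simp [e]

theorem coord (i : ι) : SmoothFunOn (fun p : ι → ℝ => p i) O :=
  ⟨{i}, fun y => y ⟨i, Finset.mem_singleton_self _⟩, (contDiff_apply ℝ ℝ _).contDiffOn,
    fun _ _ => rfl⟩

theorem const (c : ℝ) : SmoothFunOn (fun _ : ι → ℝ => c) O :=
  ⟨∅, fun _ => c, contDiffOn_const, fun _ _ => rfl⟩

theorem congr {f' : (ι → ℝ) → ℝ} (hf : SmoothFunOn f O) (h : ∀ p ∈ O, f' p = f p) :
    SmoothFunOn f' O := by
  obtain ⟨s, k, hk, hs⟩ := hf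
  exact ⟨s, k, hk, fun p hp => (h p hp).trans (hs p hp)⟩

/-- A smooth function of finitely many smooth functions is smooth. -/
theorem comp [Fintype κ] {g : (κ → ℝ) → ℝ} {U : Set (κ → ℝ)} (hg : ContDiffOn ℝ ∞ g U)
    {F : κ → (ι → ℝ) → ℝ} (hF : ∀ k, SmoothFunOn (F k) O)
    (hU : ∀ p ∈ O, (fun k => F k p) ∈ U) : SmoothFunOn (fun p => g fun k => F k p) O := by
  classical
  choose s h hh hs using hF
  let t : Finset ι := Finset.univ.biUnion s
  have ht : ∀ k, s k ⊆ t := fun k => Finset.subset_biUnion_of_mem s (Finset.mem_univ k)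
  refine ⟨t, fun y => g fun k => h k (fun i => y ⟨i, ht k i.2⟩), ?_, fun p hp => ?_⟩
  · refine hg.comp (contDiffOn_pi.2 fun k => (hh k).comp ?_ ?_) ?_
    · exact (contDiff_pi.2 fun i => contDiff_apply ℝ ℝ _).contDiffOn
    · rintro _ ⟨p, hp, rfl⟩
      exact ⟨p, hp, rfl⟩
    · rintro _ ⟨p, hp, rfl⟩
      have := hU p hp
      simp only [hs _ p hp] at this
      exact this
  · simp only [hs _ p hp]
    rfl

theorem comp_contDiff [Fintype κ] {g : (κ → ℝ) → ℝ} (hg : ContDiff ℝ ∞ g)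
    {F : κ → (ι → ℝ) → ℝ} (hF : ∀ k, SmoothFunOn (F k) O) :
    SmoothFunOn (fun p => g fun k => F k p) O :=
  comp hg.contDiffOn hF fun _ _ => mem_univ _

/-- A smooth function pulls back to a smooth function along a map with smooth
components. -/
theorem comp_map {ι' : Type*} {f : (ι' → ℝ) → ℝ} {O' : Set (ι' → ℝ)} (hf : SmoothFunOn f O')
    {φ : (ι → ℝ) → ι' → ℝ} (hφ : ∀ i, SmoothFunOn (fun p => φ p i) O) (hO : MapsTo φ O O') :
    SmoothFunOn (f ∘ φ) O := by
  obtain ⟨s, h, hh, hs⟩ := hf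
  refine (comp hh (F := fun (k : s) p => φ p k) (fun k => hφ k) fun p hp => ?_).congr
    fun p hp => hs _ (hO hp)
  exact ⟨φ p, hO hp, rfl⟩

theorem continuousOn (hf : SmoothFunOn f O) : ContinuousOn f O := by
  obtain ⟨s, h, hh, hs⟩ := hf
  refine ContinuousOn.congr (f := fun q => h (s.restrict q)) ?_ fun p hp => hs p hp
  exact hh.continuousOn.comp (Finset.continuous_restrict s).continuousOn (mapsTo_image _ _)

/-- Only derivatives along lines are used on `ℝ^ι`, which need not be normed. This makes such a
derivative local on open sets. -/
theorem eventually_line (hO : IsOpen O) {p : ι → ℝ} (hp : p ∈ O) (v : ι → ℝ) :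
    ∀ᶠ t : ℝ in 𝓝 0, p + t • v ∈ O := by
  have : Continuous fun t : ℝ => p + t • v := by fun_prop
  exact this.continuousAt.eventually_mem (by simpa using hO.mem_nhds hp)

theorem lineDeriv_congr (hO : IsOpen O) {f' : (ι → ℝ) → ℝ} (h : ∀ p ∈ O, f p = f' p) {p : ι → ℝ}
    (hp : p ∈ O) (v : ι → ℝ) : lineDeriv ℝ f p v = lineDeriv ℝ f' p v :=
  EventuallyEq.deriv_eq ((eventually_line hO hp v).mono fun _ ht => h _ ht)

/-- The chain rule for directional derivatives. -/
theorem _root_.HasFDerivAt.hasLineDerivAt_comp [Fintype κ] {g : (κ → ℝ) → ℝ}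
    {F : κ → (ι → ℝ) → ℝ} {p v : ι → ℝ} {g' : (κ → ℝ) →L[ℝ] ℝ}
    (hg : HasFDerivAt g g' fun k => F k p) (hF : ∀ k, LineDifferentiableAt ℝ (F k) p v) :
    HasLineDerivAt ℝ (fun x => g fun k => F k x) (g' fun k => lineDeriv ℝ (F k) p v) p v := by
  have h1 : HasDerivAt (fun (t : ℝ) k => F k (p + t • v)) (fun k => lineDeriv ℝ (F k) p v) 0 :=
    hasDerivAt_pi.2 fun k => (hF k).hasLineDerivAt
  have h2 : HasFDerivAt g g' ((fun (t : ℝ) k => F k (p + t • v)) 0) := by simpa using hg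
  exact h2.comp_hasDerivAt 0 h1

theorem hasLineDerivAt_coord (i : ι) (p v : ι → ℝ) :
    HasLineDerivAt ℝ (fun p : ι → ℝ => p i) (v i) p v := by
  have : HasDerivAt (fun t : ℝ => p i + t * v i) (1 * v i) 0 :=
    ((hasDerivAt_id (0 : ℝ)).mul_const (v i)).const_add (p i)
  simpa [HasLineDerivAt] using this

/-- The directional derivative of a smooth function of the coordinates in the finite set `s`. -/
theorem hasLineDerivAt_of_eq (hO : IsOpen O) {s : Finset ι} {h : (s → ℝ) → ℝ}
    (hh : ContDiffOn ℝ ∞ h (s.restrict '' O)) (hs : ∀ p ∈ O, f p = h (s.restrict p))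
    {p : ι → ℝ} (hp : p ∈ O) (v : ι → ℝ) :
    HasLineDerivAt ℝ f (fderiv ℝ h (s.restrict p) (s.restrict v)) p v := by
  have hd : HasFDerivAt h (fderiv ℝ h (s.restrict p)) fun k : s => p k :=
    ((hh.differentiableOn (by simp)).differentiableAt
      ((s.isOpen_restrict_image hO).mem_nhds ⟨p, hp, rfl⟩)).hasFDerivAt
  have h1 := hd.hasLineDerivAt_comp (F := fun (k : s) (x : ι → ℝ) => x k) (v := v)
    fun k => (hasLineDerivAt_coord _ p v).lineDifferentiableAt
  have h2 : (fun k : s => lineDeriv ℝ (fun x : ι → ℝ => x k) p v) = s.restrict v :=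
    funext fun k => (hasLineDerivAt_coord _ p v).lineDeriv
  rw [h2] at h1
  exact HasDerivAt.congr_of_eventuallyEq h1
    ((eventually_line hO hp v).mono fun _ ht => hs _ ht)

theorem lineDifferentiableAt (hf : SmoothFunOn f O) (hO : IsOpen O) {p : ι → ℝ} (hp : p ∈ O)
    (v : ι → ℝ) : LineDifferentiableAt ℝ f p v := by
  obtain ⟨s, h, hh, hs⟩ := hf
  exact (hasLineDerivAt_of_eq hO hh hs hp v).lineDifferentiableAt

end SmoothFunOn

/-! ### Cartan derivations and morphisms, checked on coordinates -/

namespace Diffiety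

variable {ι ι' : Type} [Countable ι] [Countable ι'] {D : Diffiety ι} {E : Diffiety ι'}
  {O : Set (ι → ℝ)}

theorem derivation_coord (D : Diffiety ι) (i : ι) (p : ι → ℝ) :
    D.derivation (fun p => p i) p = D.cartan p i :=
  (SmoothFunOn.hasLineDerivAt_coord i p _).lineDeriv

theorem derivation_congr (D : Diffiety ι) (hO : IsOpen O) {f f' : (ι → ℝ) → ℝ}
    (h : ∀ p ∈ O, f p = f' p) {p : ι → ℝ} (hp : p ∈ O) :
    D.derivation f p = D.derivation f' p :=
  SmoothFunOn.lineDeriv_congr hO h hp _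

/-- The ring of smooth functions is stable under the Cartan derivation. -/
theorem smooth_derivation (hO : IsOpen O) (hOD : O ⊆ D.carrier) {f : (ι → ℝ) → ℝ}
    (hf : SmoothFunOn f O) : SmoothFunOn (D.derivation f) O := by
  obtain ⟨s, h, hh, hs⟩ := hf
  have h1 : ∀ p ∈ O, D.derivation f p = fderiv ℝ h (s.restrict p) (s.restrict (D.cartan p)) :=
    fun p hp => (SmoothFunOn.hasLineDerivAt_of_eq hO hh hs hp _).lineDeriv
  have hsO := s.isOpen_restrict_image hO
  -- The derivation of `f` is `fderiv ℝ h` at a base point applied to a direction, hence a smooth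
  -- function of two copies of the `s`-coordinates, into which `p` and `D.cartan p` are substituted.
  let U : Set (s ⊕ s → ℝ) := {y | (fun k => y (.inl k)) ∈ s.restrict '' O}
  have h2 : ContDiffOn ℝ ∞ (fun y : s ⊕ s → ℝ =>
      fderiv ℝ h (fun k => y (.inl k)) fun k => y (.inr k)) U := by
    have hl : ContDiff ℝ ∞ fun (y : s ⊕ s → ℝ) (k : s) => y (.inl k) :=
      contDiff_pi.2 fun k => contDiff_apply ℝ ℝ _
    have hr : ContDiff ℝ ∞ fun (y : s ⊕ s → ℝ) (k : s) => y (.inr k) :=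
      contDiff_pi.2 fun k => contDiff_apply ℝ ℝ _
    refine ContDiffOn.clm_apply ?_ hr.contDiffOn
    exact (hh.fderiv_of_isOpen hsO (by simp)).comp hl.contDiffOn fun y hy => hy
  refine (SmoothFunOn.comp h2
    (F := Sum.elim (fun (k : s) (p : ι → ℝ) => p k) fun (k : s) p => D.cartan p k) ?_ ?_).congr h1
  · rintro (k | k)
    · exact SmoothFunOn.coord _
    · exact (D.smooth_cartan _).mono hOD
  · intro p hp
    exact ⟨p, hp, rfl⟩

theorem smooth_derivation_iterate (hO : IsOpen O) (hOD : O ⊆ D.carrier) {f : (ι → ℝ) → ℝ}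
    (hf : SmoothFunOn f O) (k : ℕ) : SmoothFunOn (D.derivation^[k] f) O := by
  induction k with
  | zero => exact hf
  | succ k ih =>
    rw [Function.iterate_succ_apply']
    exact smooth_derivation hO hOD ih

/-- A map between open subsets of diffieties whose components are smooth, and that relates the
Cartan fields, commutes with the Cartan derivations. -/
theorem derivation_comp_map {φ : (ι → ℝ) → ι' → ℝ} (hO : IsOpen O)
    (hφ : ∀ i, SmoothFunOn (fun p => φ p i) O)
    (hd : ∀ i, ∀ p ∈ O, D.derivation (fun p => φ p i) p = E.cartan (φ p) i)
    {O' : Set (ι' → ℝ)} (hO' : IsOpen O') (hm : MapsTo φ O O') {f : (ι' → ℝ) → ℝ}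
    (hf : SmoothFunOn f O') {p : ι → ℝ} (hp : p ∈ O) :
    D.derivation (f ∘ φ) p = E.derivation f (φ p) := by
  obtain ⟨s, h, hh, hs⟩ := hf
  have h1 : E.derivation f (φ p) = _ :=
    (SmoothFunOn.hasLineDerivAt_of_eq hO' hh hs (hm hp) _).lineDeriv
  have hdh : HasFDerivAt h (fderiv ℝ h (s.restrict (φ p))) fun k : s => φ p k :=
    ((hh.differentiableOn (by simp)).differentiableAt
      ((s.isOpen_restrict_image hO').mem_nhds ⟨_, hm hp, rfl⟩)).hasFDerivAt
  have h2 := hdh.hasLineDerivAt_comp (F := fun (k : s) x => φ x k) (v := D.cartan p)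
    fun k => (hφ k).lineDifferentiableAt hO hp _
  rw [h1]
  refine (D.derivation_congr hO (f' := fun x => h fun k : s => φ x k)
    (fun x hx => hs _ (hm hx)) hp).trans ?_
  refine h2.lineDeriv.trans ?_
  congr 1
  exact funext fun k => hd k p hp

/-- By the chain rule, both conditions on arbitrary smooth functions reduce to conditions on the
coordinate functions of the target. -/
theorem isMorphism_restrict {φ : (ι → ℝ) → ι' → ℝ} (hO : IsOpen O) {O' : Set (ι' → ℝ)}
    (hO' : IsOpen O') (hm : MapsTo φ (D.carrier ∩ O) (E.carrier ∩ O'))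
    (hφ : ∀ i, SmoothFunOn (fun p => φ p i) (D.carrier ∩ O))
    (hd : ∀ i, ∀ p ∈ D.carrier ∩ O, D.derivation (fun p => φ p i) p = E.cartan (φ p) i) :
    (D.restrict O hO).IsMorphism (E.restrict O' hO') φ where
  mapsTo := hm
  smooth _ hf := hf.comp_map hφ hm
  derivation_comp _ hf _ hp :=
    derivation_comp_map (D.isOpen_carrier.inter hO) hφ hd (E.isOpen_carrier.inter hO') hm hf hp

end Diffiety

/-! ### Solving for a block of coordinates -/

section Solve

variable {κ n : Type} [Fintype κ]

/-- The inverse function theorem for smooth self-maps of `ℝ^κ`, with a smooth local inverse on an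
open set. -/
theorem ContDiff.exists_local_inverse {Θ : (κ → ℝ) → κ → ℝ} (hΘ : ContDiff ℝ ∞ Θ) {v₀ : κ → ℝ}
    (hinj : Function.Injective (fderiv ℝ Θ v₀)) :
    ∃ (B C : Set (κ → ℝ)) (G : (κ → ℝ) → κ → ℝ), IsOpen B ∧ IsOpen C ∧ v₀ ∈ B ∧
      ContDiffOn ℝ ∞ G C ∧ (∀ c ∈ C, Θ (G c) = c) ∧ ∀ b ∈ B, Θ b ∈ C ∧ G (Θ b) = b := by
  let e : (κ → ℝ) ≃L[ℝ] (κ → ℝ) :=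
    (LinearEquiv.ofInjectiveEndo (fderiv ℝ Θ v₀ : (κ → ℝ) →ₗ[ℝ] (κ → ℝ))
      hinj).toContinuousLinearEquiv
  have he : (e : (κ → ℝ) →L[ℝ] (κ → ℝ)) = fderiv ℝ Θ v₀ := by
    ext1 x
    rfl
  have hdiff : Differentiable ℝ Θ := hΘ.differentiable (by simp)
  have hd : HasFDerivAt Θ (e : (κ → ℝ) →L[ℝ] (κ → ℝ)) v₀ := by
    rw [he]
    exact (hdiff v₀).hasFDerivAt
  let T := (hΘ.contDiffAt (x := v₀)).toOpenPartialHomeomorph Θ hd (by simp)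
  have hTc : (T : (κ → ℝ) → κ → ℝ) = Θ := rfl
  -- The local inverse is smooth at the image of a point where the derivative is invertible. This is
  -- an open condition, so source and target are cut down to it.
  let R : Set (κ → ℝ) := fderiv ℝ Θ ⁻¹' range ((↑) : ((κ → ℝ) ≃L[ℝ] (κ → ℝ)) → _)
  have hR : IsOpen R := ContinuousLinearEquiv.isOpen.preimage (hΘ.continuous_fderiv (by simp))
  refine ⟨T.source ∩ R, T.target ∩ T.symm ⁻¹' R, T.symm, T.open_source.inter hR,
    T.symm.isOpen_inter_preimage hR, ⟨?_, e, he⟩, ?_, fun c hc => ?_, fun b hb => ⟨⟨?_, ?_⟩, ?_⟩⟩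
  · exact ContDiffAt.mem_toOpenPartialHomeomorph_source _ hd _
  · rintro c ⟨hc, e', he'⟩
    refine (T.contDiffAt_symm hc (f₀' := e') ?_ hΘ.contDiffAt).contDiffWithinAt
    rw [he']
    exact (hdiff _).hasFDerivAt
  · exact T.right_inv hc.1
  · exact T.map_source hb.1
  · have : T.symm (Θ b) = b := T.left_inv hb.1
    simpa [this] using hb.2
  · exact T.left_inv hb.1

variable [DecidableEq κ] [Fintype n] [DecidableEq n]

theorem partialDeriv_eq_fderiv {f : (κ → ℝ) → ℝ} {v : κ → ℝ} (hf : DifferentiableAt ℝ f v)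
    (ξ : κ) : partialDeriv f ξ v = fderiv ℝ f v (Pi.single ξ 1) := by
  have h1 : HasDerivAt (Function.update v ξ) (Pi.single ξ (1 : ℝ)) (v ξ) :=
    hasDerivAt_update v ξ (v ξ)
  have h2 : HasFDerivAt f (fderiv ℝ f v) (Function.update v ξ (v ξ)) := by
    simpa using hf.hasFDerivAt
  exact (h2.comp_hasDerivAt _ h1).deriv

/-- The equations `F v = y` can be solved smoothly for the coordinates `U` of `v`, if the
corresponding minor of the Jacobian matrix does not vanish. -/
theorem exists_solve {F : (κ → ℝ) → n → ℝ} (hF : ∀ i, ContDiff ℝ ∞ fun v => F v i) {U : n → κ}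
    (hU : Function.Injective U) {v₀ : κ → ℝ}
    (hdet : (Matrix.of fun i j => partialDeriv (fun v => F v i) (U j) v₀).det ≠ 0) :
    ∃ (B C : Set (κ → ℝ)) (G : (κ → ℝ) → κ → ℝ), IsOpen B ∧ IsOpen C ∧ v₀ ∈ B ∧
      ContDiffOn ℝ ∞ G C ∧
      (∀ c ∈ C, (∀ k ∉ range U, G c k = c k) ∧ ∀ i, F (G c) i = c (U i)) ∧
      ∀ b ∈ B, Function.extend U (F b) b ∈ C ∧ G (Function.extend U (F b) b) = b := by
  -- `Θ` overwrites the `U`-coordinates of `v` by `F v` and keeps the others. Its Jacobian is block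
  -- triangular, with an identity block and the given minor.
  let Θ : (κ → ℝ) → κ → ℝ := fun v => Function.extend U (F v) v
  have hin : ∀ v i, Θ v (U i) = F v i := fun v i => hU.extend_apply _ _ _
  have hout : ∀ v, ∀ k ∉ range U, Θ v k = v k := fun v k hk => Function.extend_apply' _ _ _ hk
  have hΘ : ContDiff ℝ ∞ Θ := by
    refine contDiff_pi.2 fun k => ?_
    by_cases hk : k ∈ range U
    · obtain ⟨i, rfl⟩ := hk
      simpa only [hin] using hF i
    · simpa only [hout _ k hk] using contDiff_apply ℝ ℝ k
  have hdΘ : ∀ k, fderiv ℝ (fun v => Θ v k) v₀ = (ContinuousLinearMap.proj k).comp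
      (fderiv ℝ Θ v₀) := fun k => by
    have := hasFDerivAt_pi'.1 ((hΘ.differentiable (by simp)) v₀).hasFDerivAt k
    exact this.fderiv
  have hinj : Function.Injective (fderiv ℝ Θ v₀) := by
    rw [injective_iff_map_eq_zero]
    intro x hx
    have h0 : ∀ k, fderiv ℝ (fun v => Θ v k) v₀ x = 0 := fun k => by simp [hdΘ, hx]
    have hx1 : ∀ k ∉ range U, x k = 0 := fun k hk => by
      have := h0 k
      simp only [hout _ k hk] at this
      rwa [(hasFDerivAt_apply k v₀).fderiv] at this
    -- A kernel vector vanishes outside `U`, so its `U`-part is killed by the nonsingular minor.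
    have hxs : x = ∑ j, x (U j) • Pi.single (U j) (1 : ℝ) := by
      funext k
      by_cases hk : k ∈ range U
      · obtain ⟨i, rfl⟩ := hk
        simp [Finset.sum_apply, Pi.single_apply, hU.eq_iff]
      · rw [hx1 k hk, Finset.sum_apply, Finset.sum_eq_zero]
        intro j _
        have : k ≠ U j := fun h => hk ⟨j, h.symm⟩
        simp [this]
    have hmul : (Matrix.of fun i j => partialDeriv (fun v => F v i) (U j) v₀) *ᵥ
        (fun j => x (U j)) = 0 := by
      funext i
      have h1 := h0 (U i)
      simp only [hin] at h1
      rw [hxs, map_sum] at h1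
      simp only [Matrix.mulVec, dotProduct, Matrix.of_apply, Pi.zero_apply]
      rw [← h1]
      refine Finset.sum_congr rfl fun j _ => ?_
      rw [partialDeriv_eq_fderiv ((hF i).differentiable (by simp) v₀), map_smul, smul_eq_mul,
        mul_comm]
    have hz := Matrix.eq_zero_of_mulVec_eq_zero hdet hmul
    funext k
    by_cases hk : k ∈ range U
    · obtain ⟨i, rfl⟩ := hk
      exact congrFun hz i
    · exact hx1 k hk
  obtain ⟨B, C, G, hB, hC, hv, hG, hr, hl⟩ := hΘ.exists_local_inverse hinj
  refine ⟨B, C, G, hB, hC, hv, hG, fun c hc => ⟨fun k hk => ?_, fun i => ?_⟩, hl⟩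
  · rw [← hout (G c) k hk, hr c hc]
  · rw [← hin, hr c hc]

end Solve

/-! ### Partial inverses -/

/-- On the open set `W`, the map `g` recovers from `φ p` those values `val p k` for which `k ∈ K`;
the other components of `g` are frozen at their values at `η`. -/
structure PartialInverse {ι ι' κ : Type} (φ : (ι → ℝ) → ι' → ℝ) (val : (ι → ℝ) → κ → ℝ)
    (η : ι → ℝ) (K : Set κ) (O : Set (ι → ℝ)) (W : Set (ι' → ℝ)) (g : (ι' → ℝ) → κ → ℝ) :
    Prop where
  isOpen_source : IsOpen O
  isOpen_target : IsOpen W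
  mem_source : η ∈ O
  mapsTo : MapsTo φ O W
  smooth : ∀ k, SmoothFunOn (fun w => g w k) W
  apply_eq : ∀ p ∈ O, ∀ k ∈ K, g (φ p) k = val p k
  frozen : ∀ w, ∀ k ∉ K, g w k = val η k

/-- A partial inverse can be extended to the coordinates for which a system of equations can be
solved. -/
theorem PartialInverse.exists_extend {ι ι' κ n : Type} [Fintype κ] [DecidableEq κ] [Fintype n]
    [DecidableEq n] {φ : (ι → ℝ) → ι' → ℝ} {val : (ι → ℝ) → κ → ℝ}
    {η : ι → ℝ} {K : Set κ} {O : Set (ι → ℝ)} {W : Set (ι' → ℝ)} {g : (ι' → ℝ) → κ → ℝ}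
    (h : PartialInverse φ val η K O W g) (hval : Continuous val) {F : (κ → ℝ) → n → ℝ}
    (hF : ∀ i, ContDiff ℝ ∞ fun v => F v i) {U : n → κ} (hU : Function.Injective U)
    (hUK : ∀ i, U i ∉ K)
    (hdet : (Matrix.of fun i j => partialDeriv (fun v => F v i) (U j) (val η)).det ≠ 0)
    (hFK : DependsOn F (K ∪ range U)) {y : (ι' → ℝ) → n → ℝ}
    (hy : ∀ i, SmoothFunOn (fun w => y w i) W) (hyφ : ∀ p ∈ O, y (φ p) = F (val p)) :
    ∃ O' ⊆ O, ∃ W' ⊆ W, ∃ g', PartialInverse φ val η (K ∪ range U) O' W' g' ∧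
      (∀ w, ∀ k ∈ K, g' w k = g w k) ∧ ∀ w ∈ W', F (g' w) = y w := by
  classical
  obtain ⟨B, C, G, hB, hC, hv, hG, hr, hl⟩ := exists_solve hF hU hdet
  -- The argument fed to the local inverse `G`: prescribed values `y w` in the slots `U`, the values
  -- already known (or frozen) elsewhere.
  let e : (ι' → ℝ) → κ → ℝ := fun w => Function.extend U (y w) (g w)
  have he : ∀ k, SmoothFunOn (fun w => e w k) W := fun k => by
    by_cases hk : k ∈ range U
    · obtain ⟨i, rfl⟩ := hk
      exact (hy i).congr fun w _ => hU.extend_apply _ _ _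
    · exact (h.smooth k).congr fun w _ => Function.extend_apply' _ _ _ hk
  -- `G` expects all coordinates, but those outside `K ∪ range U` are not yet recovered. They are
  -- frozen at `η`, which does not affect `F` by `hFK`.
  let q : (ι → ℝ) → κ → ℝ := fun p k => if k ∈ K ∪ range U then val p k else val η k
  have hq : Continuous q := by
    refine continuous_pi fun k => ?_
    by_cases hk : k ∈ K ∪ range U
    · simpa only [q, hk, if_true] using continuous_pi_iff.1 hval k
    · simpa only [q, hk, if_false] using continuous_const
  have hqη : q η = val η := by
    funext k
    simp [q]
  have hqK : ∀ p, ∀ k ∈ K ∪ range U, q p k = val p k := fun p k hk => if_pos hk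
  have heq : ∀ p ∈ O, e (φ p) = Function.extend U (F (q p)) (q p) := fun p hp => by
    have h1 : F (q p) = y (φ p) := by
      rw [hyφ p hp]
      exact hFK fun k hk => hqK p k hk
    funext k
    by_cases hk : k ∈ range U
    · obtain ⟨i, rfl⟩ := hk
      simp only [e, hU.extend_apply, h1]
    · simp only [e, Function.extend_apply' _ _ _ hk]
      by_cases hkK : k ∈ K
      · rw [hqK p k (.inl hkK), h.apply_eq p hp k hkK]
      · rw [h.frozen _ k hkK]
        exact (if_neg (by simp only [mem_union, not_or]; exact ⟨hkK, hk⟩)).symm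
  -- Outside `U` the old `g` is kept by definition rather than through `G`, so that the agreement on
  -- `K` and the freezing hold for every `w`, even where `e w ∉ C`.
  let g' : (ι' → ℝ) → κ → ℝ := fun w k => if k ∈ range U then G (e w) k else g w k
  have hg' : ∀ w, e w ∈ C → g' w = G (e w) := fun w hw => by
    funext k
    by_cases hk : k ∈ range U
    · exact if_pos hk
    · refine (if_neg hk).trans ?_
      rw [(hr _ hw).1 k hk]
      exact (Function.extend_apply' _ _ _ hk).symm
  have hecont : ContinuousOn e W := continuousOn_pi.2 fun k => (he k).continuousOn
  refine ⟨O ∩ q ⁻¹' B, inter_subset_left, W ∩ e ⁻¹' C, inter_subset_left, g',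
    ⟨h.isOpen_source.inter (hB.preimage hq), hecont.isOpen_inter_preimage h.isOpen_target hC,
      ⟨h.mem_source, by simpa [hqη] using hv⟩, fun p hp => ⟨h.mapsTo hp.1, ?_⟩, fun k => ?_,
      fun p hp k hk => ?_, fun w k hk => ?_⟩, fun w k hk => ?_, fun w hw => ?_⟩
  · rw [mem_preimage, heq p hp.1]
    exact (hl _ hp.2).1
  · refine (SmoothFunOn.comp (g := fun v => G v k) (F := fun k w => e w k) (contDiffOn_pi.1 hG k)
      (fun k => (he k).mono inter_subset_left) fun w hw => hw.2).congr fun w hw => ?_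
    rw [hg' w hw.2]
  · have hmem : e (φ p) ∈ C := by
      rw [heq p hp.1]
      exact (hl _ hp.2).1
    rw [hg' _ hmem, heq p hp.1, (hl _ hp.2).2, hqK p k hk]
  · simp only [mem_union, not_or] at hk
    exact (if_neg hk.2).trans (h.frozen w k hk.1)
  · exact if_neg fun ⟨i, hi⟩ => hUK i (hi ▸ hk)
  · rw [hg' w hw.2]
    funext i
    rw [(hr _ hw.2).2 i]
    exact hU.extend_apply _ _ _

/-! ### Prolongations of control systems -/

namespace ControlSystem

variable {σ κ : Type} {m : ℕ}

/-- The map from the jet space to the diffiety of a control system given by states and controls,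
and the derivatives of the controls. -/
def inverseMap (g : (JetCoord m → ℝ) → σ ⊕ κ → ℝ) (w : JetCoord m → ℝ) : SystemCoord σ κ → ℝ
  | none => w none
  | some (.inl i) => g w (.inl i)
  | some (.inr (j, k)) => (jetSpace m).derivation^[k] (fun w => g w (.inr j)) w

/-- The time derivatives of the states given as functions on the jet space. -/
def velocity (g : (JetCoord m → ℝ) → σ ⊕ κ → ℝ) (w : JetCoord m → ℝ) (i : σ) : ℝ :=
  (jetSpace m).derivation (fun w => g w (.inl i)) w

theorem _root_.SystemCoord.continuous_values :
    Continuous (SystemCoord.values : (SystemCoord σ κ → ℝ) → σ ⊕ κ → ℝ) :=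
  continuous_pi fun _ => continuous_apply _

theorem smooth_velocity {g : (JetCoord m → ℝ) → σ ⊕ κ → ℝ} {W : Set (JetCoord m → ℝ)}
    (hW : IsOpen W) (hg : ∀ k, SmoothFunOn (fun w => g w k) W) (i : σ) :
    SmoothFunOn (fun w => velocity g w i) W :=
  Diffiety.smooth_derivation hW (subset_univ _) (hg _)

/-- The variables `K` determine the value of `R`, a function of the states, the controls and the
derivatives of the states. -/
def VelocityDependsOn {β : Type} (R : (σ ⊕ κ → ℝ) → (σ → ℝ) → β) (K : Set (σ ⊕ κ)) : Prop :=
  ∀ ⦃v v' : σ ⊕ κ → ℝ⦄ ⦃d d' : σ → ℝ⦄, (∀ k ∈ K, v k = v' k) →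
    (∀ i, .inl i ∈ K → d i = d' i) → R v d = R v' d'

theorem VelocityDependsOn.mono {β : Type} {R : (σ ⊕ κ → ℝ) → (σ → ℝ) → β} {K K' : Set (σ ⊕ κ)}
    (hR : VelocityDependsOn R K) (hK : K ⊆ K') : VelocityDependsOn R K' :=
  fun _ _ _ _ hv hd => hR (fun k hk => hv k (hK hk)) fun i hi => hd i (hK hi)

/-- Agreement on `K` at all `w`, not just at one, makes the component functions equal and hence also
their derivatives. This lets equations solved at one stage survive the later ones. -/
theorem VelocityDependsOn.apply_velocity {β : Type} {R : (σ ⊕ κ → ℝ) → (σ → ℝ) → β}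
    {K : Set (σ ⊕ κ)} (hR : VelocityDependsOn R K) {g g' : (JetCoord m → ℝ) → σ ⊕ κ → ℝ}
    (hg : ∀ w, ∀ k ∈ K, g' w k = g w k) (w : JetCoord m → ℝ) :
    R (g' w) (velocity g' w) = R (g w) (velocity g w) := by
  refine hR (hg w) fun i hi => ?_
  have : (fun w => g' w (.inl i)) = fun w => g w (.inl i) := funext fun w => hg w _ hi
  simp only [velocity, this]

variable [Fintype σ] [Fintype κ]

/-- The map from the diffiety of a control system to the jet space given by the derivatives of the
variables `out`. -/
def jetMap (Sys : ControlSystem σ κ) (out : Fin m → σ ⊕ κ) (p : SystemCoord σ κ → ℝ) :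
    JetCoord m → ℝ
  | none => p none
  | some (j, k) => Sys.diffiety.derivation^[k] (fun p => SystemCoord.values p (out j)) p

variable {Sys : ControlSystem σ κ} {out : Fin m → σ ⊕ κ}

theorem smooth_jetMap (c : JetCoord m) :
    SmoothFunOn (fun p => Sys.jetMap out p c) Sys.diffiety.carrier := by
  rcases c with _ | ⟨j, k⟩
  · exact SmoothFunOn.coord _
  · exact Diffiety.smooth_derivation_iterate Sys.diffiety.isOpen_carrier subset_rfl
      (SmoothFunOn.coord _) k

/-- The components are successive derivatives, so `jetMap` respects the Cartan fields for any choice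
of outputs. The content of flatness is its local invertibility. -/
theorem derivation_jetMap (c : JetCoord m) (p : SystemCoord σ κ → ℝ) :
    Sys.diffiety.derivation (fun p => Sys.jetMap out p c) p =
      (jetSpace m).cartan (Sys.jetMap out p) c := by
  rcases c with _ | ⟨j, k⟩
  · exact Sys.diffiety.derivation_coord none p
  · change _ = Sys.diffiety.derivation^[k + 1] _ p
    rw [Function.iterate_succ_apply']
    rfl

theorem derivation_comp_jetMap {O : Set (SystemCoord σ κ → ℝ)} {W : Set (JetCoord m → ℝ)}
    (hO : IsOpen O) (hOc : O ⊆ Sys.diffiety.carrier) (hW : IsOpen W)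
    (hm : MapsTo (Sys.jetMap out) O W) {f : (JetCoord m → ℝ) → ℝ} (hf : SmoothFunOn f W)
    {p : SystemCoord σ κ → ℝ} (hp : p ∈ O) :
    Sys.diffiety.derivation (f ∘ Sys.jetMap out) p =
      (jetSpace m).derivation f (Sys.jetMap out p) :=
  Diffiety.derivation_comp_map hO (fun c => (smooth_jetMap c).mono hOc)
    (fun c p _ => derivation_jetMap c p) hW hm hf hp

/-- Pullback by `jetMap` commutes with the derivations, and the pullback of a recovered state is
that state on `O`; its derivative is the right-hand side of the system. -/
theorem velocity_jetMap {η : SystemCoord σ κ → ℝ} {K : Set (σ ⊕ κ)}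
    {O : Set (SystemCoord σ κ → ℝ)} {W : Set (JetCoord m → ℝ)} {g : (JetCoord m → ℝ) → σ ⊕ κ → ℝ}
    (h : PartialInverse (Sys.jetMap out) SystemCoord.values η K O W g)
    (hO : O ⊆ Sys.diffiety.carrier) {p : SystemCoord σ κ → ℝ} (hp : p ∈ O) {i : σ}
    (hi : .inl i ∈ K) :
    velocity g (Sys.jetMap out p) i = Sys.f (p none, SystemCoord.values p) i := by
  rw [velocity, ← derivation_comp_jetMap h.isOpen_source hO h.isOpen_target h.mapsTo (h.smooth _) hp]
  refine (Sys.diffiety.derivation_congr h.isOpen_source (f' := fun p => p (some (.inl i)))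
    (fun p hp => h.apply_eq p hp _ hi) hp).trans ?_
  exact Sys.diffiety.derivation_coord _ p

/-- If the consequence `F = R` of the equations of a control system can be solved for the variables
`U`, then a partial inverse can be extended to these variables. -/
theorem exists_extend [DecidableEq σ] [DecidableEq κ] {n : Type} [Fintype n] [DecidableEq n]
    {η : SystemCoord σ κ → ℝ} {K : Set (σ ⊕ κ)}
    {O : Set (SystemCoord σ κ → ℝ)} {W : Set (JetCoord m → ℝ)} {g : (JetCoord m → ℝ) → σ ⊕ κ → ℝ}
    (h : PartialInverse (Sys.jetMap out) SystemCoord.values η K O W g)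
    (hO : O ⊆ Sys.diffiety.carrier) {F : (σ ⊕ κ → ℝ) → n → ℝ}
    (hF : ∀ i, ContDiff ℝ ∞ fun v => F v i) {U : n → σ ⊕ κ} (hU : Function.Injective U)
    (hUK : ∀ i, U i ∉ K)
    (hdet : (Matrix.of fun i j =>
      partialDeriv (fun v => F v i) (U j) (SystemCoord.values η)).det ≠ 0)
    (hFK : DependsOn F (K ∪ range U)) {R : (σ ⊕ κ → ℝ) → (σ → ℝ) → n → ℝ}
    (hR : ∀ i, ContDiff ℝ ∞ fun x : (σ ⊕ κ → ℝ) × (σ → ℝ) => R x.1 x.2 i)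
    (hRK : VelocityDependsOn R K)
    (hFR : ∀ p ∈ Sys.diffiety.carrier, F (SystemCoord.values p) =
      R (SystemCoord.values p) (Sys.f (p none, SystemCoord.values p))) :
    ∃ O' ⊆ O, ∃ W' ⊆ W, ∃ g',
      PartialInverse (Sys.jetMap out) SystemCoord.values η (K ∪ range U) O' W' g' ∧
      (∀ w, ∀ k ∈ K, g' w k = g w k) ∧ ∀ w ∈ W', F (g' w) = R (g' w) (velocity g' w) := by
  have hsmooth : ∀ i, SmoothFunOn (fun w => R (g w) (velocity g w) i) W := fun i => by
    -- The pair (variables, velocities) is encoded as one finite family of coordinates, the form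
    -- required by `SmoothFunOn.comp_contDiff`.
    have hc : ContDiff ℝ ∞ fun x : (σ ⊕ κ) ⊕ σ → ℝ =>
        R (fun k => x (.inl k)) (fun i => x (.inr i)) i :=
      (hR i).comp ((contDiff_pi.2 fun k => contDiff_apply ℝ ℝ (Sum.inl k)).prodMk
        (contDiff_pi.2 fun k => contDiff_apply ℝ ℝ (Sum.inr k)))
    refine SmoothFunOn.comp_contDiff hc
      (F := Sum.elim (fun k w => g w k) fun i w => velocity g w i) ?_
    rintro (k | k)
    · exact h.smooth k
    · exact smooth_velocity h.isOpen_target h.smooth k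
  have heq : ∀ p ∈ O, R (g (Sys.jetMap out p)) (velocity g (Sys.jetMap out p)) =
      F (SystemCoord.values p) := fun p hp => by
    rw [hFR p (hO hp)]
    exact hRK (h.apply_eq p hp) fun i hi => velocity_jetMap h hO hp hi
  obtain ⟨O', hO', W', hW', g', h', hgg', hFg'⟩ := h.exists_extend SystemCoord.continuous_values
    hF hU hUK hdet hFK hsmooth heq
  exact ⟨O', hO', W', hW', g', h', hgg', fun w hw => by
    rw [hFg' w hw, hRK.apply_velocity hgg']⟩

/-- Variables of a control system form a regular flat output if states and controls can be
recovered from them, and if these functions on the jet space solve the equations of the system. -/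
theorem isRegularFlatOutputAt_of_partialInverse {η : SystemCoord σ κ → ℝ}
    {O : Set (SystemCoord σ κ → ℝ)} {W : Set (JetCoord m → ℝ)} {g : (JetCoord m → ℝ) → σ ⊕ κ → ℝ}
    (h : PartialInverse (Sys.jetMap out) SystemCoord.values η univ O W g)
    (hO : O ⊆ Sys.diffiety.carrier)
    (hsol : ∀ w ∈ W, (w none, g w) ∈ Sys.dom → velocity g w = Sys.f (w none, g w))
    (hout : ∀ w ∈ W, ∀ j, g w (out j) = w (some (j, 0))) :
    Sys.diffiety.IsRegularFlatOutputAt (fun j p => SystemCoord.values p (out j)) η := by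
  set ψ : (JetCoord m → ℝ) → SystemCoord σ κ → ℝ := inverseMap g
  have hψsmooth : ∀ c, SmoothFunOn (fun w => ψ w c) W := by
    rintro (_ | i | ⟨j, k⟩)
    · exact SmoothFunOn.coord _
    · exact h.smooth _
    · exact Diffiety.smooth_derivation_iterate h.isOpen_target (subset_univ _) (h.smooth _) k
  have hψval : ∀ w, SystemCoord.values (ψ w) = g w := fun w => by
    funext v
    cases v <;> rfl
  -- On `W₁` the map `ψ` lands in `O`, hence in the domain of the system, so `hsol` applies there.
  set W₁ : Set (JetCoord m → ℝ) := W ∩ ψ ⁻¹' O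
  have hW₁ : IsOpen W₁ :=
    (continuousOn_pi.2 fun c => (hψsmooth c).continuousOn).isOpen_inter_preimage h.isOpen_target
      h.isOpen_source
  have hψd : ∀ c, ∀ w ∈ W₁, (jetSpace m).derivation (fun w => ψ w c) w =
      Sys.diffiety.cartan (ψ w) c := by
    rintro (_ | i | ⟨j, k⟩) w hw
    · exact (jetSpace m).derivation_coord none w
    · have h1 : (w none, g w) ∈ Sys.dom := by
        have := hO hw.2
        rwa [← hψval w]
      have h2 := congrFun (hsol w hw.1 h1) i
      change velocity g w i = Sys.f (w none, SystemCoord.values (ψ w)) i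
      rw [h2, hψval]
    · change _ = (jetSpace m).derivation^[k + 1] _ w
      rw [Function.iterate_succ_apply']
      rfl
  have hψφ : ∀ p ∈ O, ψ (Sys.jetMap out p) = p := by
    intro p hp
    funext c
    rcases c with _ | i | ⟨j, k⟩
    · rfl
    · exact h.apply_eq p hp _ (mem_univ _)
    -- The identity at order `k` is differentiated to reach order `k + 1`, so it must be available
    -- on the whole open set `O`, not at one point.
    · induction k generalizing p with
      | zero => exact h.apply_eq p hp (.inr j) (mem_univ _)
      | succ k ih =>
        change (jetSpace m).derivation^[k + 1] (fun w => g w (.inr j)) _ = _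
        rw [Function.iterate_succ_apply']
        refine (derivation_comp_jetMap h.isOpen_source hO h.isOpen_target h.mapsTo
          (hψsmooth (some (.inr (j, k)))) hp).symm.trans ?_
        refine (Sys.diffiety.derivation_congr h.isOpen_source
          (f' := fun p => p (some (.inr (j, k)))) (fun p hp => ih p hp) hp).trans ?_
        exact Sys.diffiety.derivation_coord _ p
  have hφψ : ∀ w ∈ W₁, Sys.jetMap out (ψ w) = w := by
    intro w hw
    funext c
    rcases c with _ | ⟨j, k⟩
    · rfl
    · induction k generalizing w with
      | zero =>
        change SystemCoord.values (ψ w) (out j) = _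
        rw [hψval, hout w hw.1]
      | succ k ih =>
        change Sys.diffiety.derivation^[k + 1] _ _ = _
        rw [Function.iterate_succ_apply']
        refine (Diffiety.derivation_comp_map hW₁ (fun c => (hψsmooth c).mono inter_subset_left)
          hψd h.isOpen_source (fun w hw => hw.2)
          ((smooth_jetMap (some (j, k))).mono hO) hw).symm.trans ?_
        refine ((jetSpace m).derivation_congr hW₁ (f' := fun w => w (some (j, k)))
          (fun w hw => ih w hw) hw).trans ?_
        exact (jetSpace m).derivation_coord _ w
  have hφW : MapsTo (Sys.jetMap out) O W₁ := fun p hp =>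
    ⟨h.mapsTo hp, by simpa only [mem_preimage, hψφ p hp] using hp⟩
  refine ⟨O, Sys.jetMap out, ⟨hO h.mem_source, h.mem_source, h.isOpen_source, W₁, hW₁,
    ⟨Diffiety.isMorphism_restrict h.isOpen_source hW₁ (fun p hp => ⟨mem_univ _, hφW hp.2⟩)
      (fun c => (smooth_jetMap c).mono inter_subset_left) fun c p _ => derivation_jetMap c p,
    ψ, Diffiety.isMorphism_restrict hW₁ h.isOpen_source (fun w hw => ⟨hO hw.2.2, hw.2.2⟩)
      (fun c => (hψsmooth c).mono fun w hw => hw.2.1) fun c w hw => hψd c w hw.2,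
    fun p hp => hψφ p hp.2, fun w hw => hφψ w hw.2⟩⟩, fun p _ j => rfl⟩

end ControlSystem

/-- A `3 × 4` matrix of rank `3` has a nonzero maximal minor. -/
theorem Matrix.exists_det_submatrix_succAbove_ne_zero {A : Matrix (Fin 3) (Fin 4) ℝ}
    (hA : A.rank = 3) : ∃ ξ : Fin 4, (A.submatrix id ξ.succAbove).det ≠ 0 := by
  have hker : Module.finrank ℝ (LinearMap.ker A.mulVecLin) = 1 := by
    have h := LinearMap.finrank_range_add_finrank_ker A.mulVecLin
    rw [Module.finrank_fin_fun] at h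
    have : Module.finrank ℝ (LinearMap.range A.mulVecLin) = 3 := hA
    omega
  obtain ⟨x, hx0, hx⟩ := finrank_eq_one_iff'.1 hker
  obtain ⟨ξ, hξ⟩ : ∃ ξ, x.1 ξ ≠ 0 := by
    by_contra! h
    exact hx0 (Subtype.ext (funext h))
  refine ⟨ξ, fun hdet => ?_⟩
  obtain ⟨y, hy0, hy⟩ := Matrix.exists_mulVec_eq_zero_iff.2 hdet
  -- The kernel is a line spanned by `x` with `x ξ ≠ 0`. A kernel vector of the minor, padded by `0`
  -- at `ξ`, lies on this line with vanishing `ξ`-entry, so it is zero.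
  have hz : ξ.insertNth (0 : ℝ) y ∈ LinearMap.ker A.mulVecLin := by
    rw [LinearMap.mem_ker, Matrix.mulVecLin_apply, ← hy]
    funext i
    simp [Matrix.mulVec, dotProduct, Fin.sum_univ_succAbove _ ξ]
  obtain ⟨c, hc⟩ := hx ⟨_, hz⟩
  have hc' : ∀ j, c * x.1 j = ξ.insertNth (α := fun _ => ℝ) (0 : ℝ) y j := fun j =>
    congrFun (congrArg Subtype.val hc) j
  have hc0 : c = 0 := by
    have := hc' ξ
    rw [Fin.insertNth_apply_same] at this
    exact (mul_eq_zero.1 this).resolve_right hξ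
  refine hy0 (funext fun j => ?_)
  have := hc' (ξ.succAbove j)
  rw [Fin.insertNth_apply_succAbove, hc0, zero_mul] at this
  exact this.symm

/-! ### The blocks of aircraft variables in the cascade -/

namespace Aircraft

/-- The variables whose values are the flat output. -/
def outputVar (ξ : Fin 4) : Fin 4 → State ⊕ Control :=
  ![.inl .x, .inl .y, .inl .z, Model.Xi2 ξ]

/-- Speed, path angle and heading. -/
def pathVar : Fin 3 → State ⊕ Control := ![.inl .V, .inl .γ, .inl .χ]

/-- The roll, pitch and yaw rates. -/
def rateVar : Fin 3 → State ⊕ Control := ![.inl .p, .inl .q, .inl .r]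

/-- The controls that act on the torques. -/
def torqueVar (j : Fin 3) : State ⊕ Control := .inr ((![.δl, .δm, .yaw] : Fin 3 → Control) j)

/-- The variables of `Ξ₂` other than the one with index `ξ`. -/
def attitudeVar (ξ : Fin 4) (j : Fin 3) : State ⊕ Control := Model.Xi2 (ξ.succAbove j)

theorem outputVar_injective (ξ : Fin 4) : Function.Injective (outputVar ξ) := by
  revert ξ; unfold Function.Injective; decide

theorem pathVar_injective : Function.Injective pathVar := by
  unfold Function.Injective; decide

theorem rateVar_injective : Function.Injective rateVar := by
  unfold Function.Injective; decide

theorem torqueVar_injective : Function.Injective torqueVar := by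
  unfold Function.Injective; decide

theorem attitudeVar_injective (ξ : Fin 4) : Function.Injective (attitudeVar ξ) := by
  revert ξ; unfold Function.Injective; decide

theorem pathVar_notMem (ξ : Fin 4) (i : Fin 3) : pathVar i ∉ range (outputVar ξ) := by
  have h : ∀ ξ i j, outputVar ξ j ≠ pathVar i := by decide
  rintro ⟨j, hj⟩
  exact h ξ i j hj

theorem attitudeVar_notMem (ξ : Fin 4) (i : Fin 3) :
    attitudeVar ξ i ∉ range (outputVar ξ) ∪ range pathVar := by
  have h₀ : ∀ ξ i j, outputVar ξ j ≠ attitudeVar ξ i := by decide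
  have h₁ : ∀ ξ i j, pathVar j ≠ attitudeVar ξ i := by decide
  rintro (⟨j, hj⟩ | ⟨j, hj⟩)
  · exact h₀ ξ i j hj
  · exact h₁ ξ i j hj

theorem rateVar_notMem (ξ : Fin 4) (i : Fin 3) :
    rateVar i ∉ range (outputVar ξ) ∪ range pathVar ∪ range (attitudeVar ξ) := by
  have h₀ : ∀ ξ i j, outputVar ξ j ≠ rateVar i := by decide
  have h₁ : ∀ i j, pathVar j ≠ rateVar i := by decide
  have h₂ : ∀ ξ i j, attitudeVar ξ j ≠ rateVar i := by decide
  rintro ((⟨j, hj⟩ | ⟨j, hj⟩) | ⟨j, hj⟩)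
  · exact h₀ ξ i j hj
  · exact h₁ i j hj
  · exact h₂ ξ i j hj

theorem torqueVar_notMem (ξ : Fin 4) (i : Fin 3) : torqueVar i ∉
    range (outputVar ξ) ∪ range pathVar ∪ range (attitudeVar ξ) ∪ range rateVar := by
  have h₀ : ∀ ξ i j, outputVar ξ j ≠ torqueVar i := by decide
  have h₁ : ∀ i j, pathVar j ≠ torqueVar i := by decide
  have h₂ : ∀ ξ i j, attitudeVar ξ j ≠ torqueVar i := by decide
  have h₃ : ∀ i j, rateVar j ≠ torqueVar i := by decide
  rintro (((⟨j, hj⟩ | ⟨j, hj⟩) | ⟨j, hj⟩) | ⟨j, hj⟩)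
  · exact h₀ ξ i j hj
  · exact h₁ i j hj
  · exact h₂ ξ i j hj
  · exact h₃ i j hj

/-- All the variables except the rates and the controls that act on the torques. -/
def flightVars : Set (State ⊕ Control) :=
  {.inl .x, .inl .y, .inl .z} ∪ range pathVar ∪ range Model.Xi2

/-- Whichever `ξ` is chosen as output, the other three variables of `Ξ₂` are supplied by
`attitudeVar ξ`. Dependence statements can thus be made once, with `flightVars`, for all `ξ`. -/
theorem flightVars_subset (ξ : Fin 4) :
    flightVars ⊆ range (outputVar ξ) ∪ range pathVar ∪ range (attitudeVar ξ) := by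
  rintro _ ((h | h) | ⟨j, rfl⟩)
  · rcases h with rfl | rfl | rfl
    · exact .inl (.inl ⟨0, rfl⟩)
    · exact .inl (.inl ⟨1, rfl⟩)
    · exact .inl (.inl ⟨2, rfl⟩)
  · exact .inl (.inr h)
  · by_cases hj : j = ξ
    · exact .inl (.inl ⟨3, by rw [hj]; rfl⟩)
    · obtain ⟨i, rfl⟩ := Fin.exists_succAbove_eq hj
      exact .inr ⟨i, rfl⟩

theorem mem_flightVars {c : State ⊕ Control} (h₁ : c ∉ range rateVar) (h₂ : c ∉ range torqueVar) :
    c ∈ flightVars := by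
  have key : ∀ c, (∃ i, rateVar i = c) ∨ (∃ i, torqueVar i = c) ∨ (∃ i, pathVar i = c) ∨
      (∃ i, Model.Xi2 i = c) ∨ c = .inl .x ∨ c = .inl .y ∨ c = .inl .z := by decide
  rcases key c with h | h | h | h | h
  · exact absurd h h₁
  · exact absurd h h₂
  · exact .inl (.inr h)
  · exact .inr h
  · exact .inl (.inl h)

theorem union_eq_univ (ξ : Fin 4) : range (outputVar ξ) ∪ range pathVar ∪ range (attitudeVar ξ) ∪
    range rateVar ∪ range torqueVar = univ := by
  refine eq_univ_of_forall fun c => ?_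
  by_cases h₂ : c ∈ range torqueVar
  · exact .inr h₂
  by_cases h₁ : c ∈ range rateVar
  · exact .inl (.inr h₁)
  exact .inl (.inl (flightVars_subset ξ (mem_flightVars h₁ h₂)))

/-! ### The four systems of equations to be solved -/

/-- The velocity in terms of speed, path angle and heading. -/
def pathMap (v : Point) : Fin 3 → ℝ :=
  ![v (.inl .V) * Real.cos (v (.inl .χ)) * Real.cos (v (.inl .γ)),
    v (.inl .V) * Real.sin (v (.inl .χ)) * Real.cos (v (.inl .γ)),
    -v (.inl .V) * Real.sin (v (.inl .γ))]

/-- The velocity in terms of the derivatives of the states. -/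
def pathRhs (_ : Point) (d : State → ℝ) : Fin 3 → ℝ := ![d .x, d .y, d .z]

theorem contDiff_pathMap (i : Fin 3) : ContDiff ℝ ∞ fun v => pathMap v i := by
  fin_cases i <;> simp [pathMap] <;> fun_prop

theorem contDiff_pathRhs (i : Fin 3) :
    ContDiff ℝ ∞ fun x : Point × (State → ℝ) => pathRhs x.1 x.2 i := by
  fin_cases i <;> simp [pathRhs] <;> fun_prop

/-- This is the Jacobian of spherical coordinates, equal to `V² cos γ`. -/
theorem det_pathMap {v : Point} (hv : v ∈ Model.admissible) :
    (Matrix.of fun i j => partialDeriv (fun v => pathMap v i) (pathVar j) v).det ≠ 0 := by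
  obtain ⟨⟨-, hγ⟩, hV⟩ : (Real.cos (v (.inl .β)) ≠ 0 ∧ Real.cos (v (.inl .γ)) ≠ 0) ∧
      v (.inl .V) ≠ 0 := by simpa [Model.admissible] using hv
  have h : (Matrix.of fun i j => partialDeriv (fun v => pathMap v i) (pathVar j) v).det =
      v (.inl .V) ^ 2 * Real.cos (v (.inl .γ)) := by
    rw [Matrix.det_fin_three]
    simp [partialDeriv, pathMap, pathVar, Function.update]
    linear_combination v (.inl .V) ^ 2 * Real.cos (v (.inl .γ)) *
      ((Real.sin (v (.inl .γ)) ^ 2 + Real.cos (v (.inl .γ)) ^ 2) *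
        Real.sin_sq_add_cos_sq (v (.inl .χ)) + Real.sin_sq_add_cos_sq (v (.inl .γ)))
  rw [h]
  exact mul_ne_zero (pow_ne_zero 2 hV) hγ

namespace Model

variable (A : Model)

/-- The right-hand sides for `A.Q`, in terms of the derivatives of the states. -/
def forceRhs (v : Point) (d : State → ℝ) : Fin 3 → ℝ :=
  ![A.m * d .V, -(A.m * v (.inl .V) * d .γ),
    -(Real.cos (v (.inl .γ)) * A.m * v (.inl .V) * d .χ)]

/-- The kinematic equations for the attitude, multiplied by their denominators. -/
def rateMap (v : Point) : Fin 3 → ℝ :=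
  ![A.m * v (.inl .V) * (-v (.inl .p) * Real.cos (v (.inl .α)) * Real.sin (v (.inl .β))
      + v (.inl .q) * Real.cos (v (.inl .β))
      - v (.inl .r) * Real.sin (v (.inl .α)) * Real.sin (v (.inl .β))) + A.Z v,
    A.m * v (.inl .V) * (v (.inl .p) * Real.sin (v (.inl .α))
      - v (.inl .r) * Real.cos (v (.inl .α))) + A.Y v,
    A.m * v (.inl .V) * Real.cos (v (.inl .γ)) * (v (.inl .p) * Real.cos (v (.inl .α))
      + v (.inl .r) * Real.sin (v (.inl .α)))
      + (A.Y v * Real.cos (v (.inl .μ)) * Real.sin (v (.inl .γ)) * Real.cos (v (.inl .β))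
        - A.Z v * (Real.sin (v (.inl .μ)) * Real.sin (v (.inl .γ)) * Real.cos (v (.inl .β))
          + Real.sin (v (.inl .β)) * Real.cos (v (.inl .γ))))]

/-- The derivatives of the attitude, multiplied by the denominators of their equations. -/
def rateRhs (v : Point) (d : State → ℝ) : Fin 3 → ℝ :=
  ![A.m * v (.inl .V) * Real.cos (v (.inl .β)) * d .α,
    A.m * v (.inl .V) * d .β,
    A.m * v (.inl .V) * Real.cos (v (.inl .γ)) * Real.cos (v (.inl .β)) * d .μ]

/-- The torques in terms of the derivatives of the rates. -/
def torqueRhs (v : Point) (d : State → ℝ) : Fin 3 → ℝ :=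
  A.J *ᵥ ![d .p, d .q, d .r] -
    ![(A.Iyy - A.Izz) * v (.inl .q) * v (.inl .r) + A.Ixz * v (.inl .p) * v (.inl .q),
      (A.Izz - A.Ixx) * v (.inl .p) * v (.inl .r) + A.Ixz * (v (.inl .r) ^ 2 - v (.inl .p) ^ 2),
      (A.Ixx - A.Iyy) * v (.inl .p) * v (.inl .q) - A.Ixz * v (.inl .r) * v (.inl .q)]

theorem contDiff_Q (i : Fin 3) : ContDiff ℝ ∞ fun v => A.Q i v := by
  have hX := A.contDiff_X
  have hY := A.contDiff_Y
  have hZ := A.contDiff_Z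
  fin_cases i <;> simp [Q] <;> fun_prop

theorem contDiff_forceRhs (i : Fin 3) :
    ContDiff ℝ ∞ fun x : Point × (State → ℝ) => A.forceRhs x.1 x.2 i := by
  fin_cases i <;> simp [forceRhs] <;> fun_prop

theorem contDiff_rateMap (i : Fin 3) : ContDiff ℝ ∞ fun v => A.rateMap v i := by
  have hY := A.contDiff_Y
  have hZ := A.contDiff_Z
  fin_cases i <;> simp [rateMap] <;> fun_prop

theorem contDiff_rateRhs (i : Fin 3) :
    ContDiff ℝ ∞ fun x : Point × (State → ℝ) => A.rateRhs x.1 x.2 i := by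
  fin_cases i <;> simp [rateRhs] <;> fun_prop

theorem contDiff_torqueRhs (i : Fin 3) :
    ContDiff ℝ ∞ fun x : Point × (State → ℝ) => A.torqueRhs x.1 x.2 i := by
  fin_cases i <;> simp [torqueRhs, Matrix.mulVec, dotProduct, Fin.sum_univ_three] <;> fun_prop

/-- The simplification of the model enters here: with the other arguments frozen, the force
coefficients see only `z, α, β`, so the forces are free of rates and torque controls. -/
theorem dependsOn_force : DependsOn (fun v => (A.X v, A.Y v, A.Z v)) flightVars := by
  intro v v' h
  have hp : ∀ i, v (pathVar i) = v' (pathVar i) := fun i => h _ (.inl (.inr ⟨i, rfl⟩))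
  have hx : ∀ i, v (Xi2 i) = v' (Xi2 i) := fun i => h _ (.inr ⟨i, rfl⟩)
  have hz : v (.inl .z) = v' (.inl .z) := h _ (.inl (.inl (by simp)))
  have hV : v (.inl .V) = v' (.inl .V) := hp 0
  have hγ : v (.inl .γ) = v' (.inl .γ) := hp 1
  have hα : v (.inl .α) = v' (.inl .α) := hx 0
  have hβ : v (.inl .β) = v' (.inl .β) := hx 1
  have hμ : v (.inl .μ) = v' (.inl .μ) := hx 2
  have hF : v (.inr .F) = v' (.inr .F) := hx 3
  have hs : A.simplifiedArgs v = A.simplifiedArgs v' := by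
    funext i
    cases i <;> simp [simplifiedArgs, hz, hα, hβ]
  simp only [X, Y, Z, dynamicForce, hs, hz, hV, hγ, hα, hβ, hμ, hF]

theorem apply_update_of_dependsOn {f : Point → ℝ} {s : Set (State ⊕ Control)} (hf : DependsOn f s)
    {c : State ⊕ Control} (hc : c ∉ s) (v : Point) (t : ℝ) : f (Function.update v c t) = f v :=
  hf fun k hk => Function.update_of_ne (fun h : k = c => hc (h ▸ hk)) _ _

theorem rateVar_notMem_flightVars (i : Fin 3) : rateVar i ∉ flightVars := by
  have h₀ : ∀ i, rateVar i ≠ .inl .x ∧ rateVar i ≠ .inl .y ∧ rateVar i ≠ .inl .z := by decide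
  have h₁ : ∀ i j, pathVar j ≠ rateVar i := by decide
  have h₂ : ∀ i j, Xi2 j ≠ rateVar i := by decide
  rintro ((h | ⟨j, hj⟩) | ⟨j, hj⟩)
  · exact h.elim (h₀ i).1 (fun h => h.elim (h₀ i).2.1 (h₀ i).2.2)
  · exact h₁ i j hj
  · exact h₂ i j hj

/-- As `Y` and `Z` do not involve the rates, `rateMap` is affine in `p, q, r`, and only the
kinematic coefficients contribute to the determinant. -/
theorem det_rateMap {v : Point} (hv : v ∈ admissible) :
    (Matrix.of fun i j => partialDeriv (fun v => A.rateMap v i) (rateVar j) v).det ≠ 0 := by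
  obtain ⟨⟨hβ, hγ⟩, hV⟩ : (Real.cos (v (.inl .β)) ≠ 0 ∧ Real.cos (v (.inl .γ)) ≠ 0) ∧
      v (.inl .V) ≠ 0 := by simpa [admissible] using hv
  have hYd : DependsOn A.Y flightVars := fun v v' h => congrArg (·.2.1) (A.dependsOn_force h)
  have hZd : DependsOn A.Z flightVars := fun v v' h => congrArg (·.2.2) (A.dependsOn_force h)
  have hY := fun i => apply_update_of_dependsOn hYd (rateVar_notMem_flightVars i) v
  have hZ := fun i => apply_update_of_dependsOn hZd (rateVar_notMem_flightVars i) v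
  have hYp : ∀ t, A.Y (Function.update v (.inl .p) t) = A.Y v := hY 0
  have hYq : ∀ t, A.Y (Function.update v (.inl .q) t) = A.Y v := hY 1
  have hYr : ∀ t, A.Y (Function.update v (.inl .r) t) = A.Y v := hY 2
  have hZp : ∀ t, A.Z (Function.update v (.inl .p) t) = A.Z v := hZ 0
  have hZq : ∀ t, A.Z (Function.update v (.inl .q) t) = A.Z v := hZ 1
  have hZr : ∀ t, A.Z (Function.update v (.inl .r) t) = A.Z v := hZ 2
  have h : (Matrix.of fun i j => partialDeriv (fun v => A.rateMap v i) (rateVar j) v).det =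
      -((A.m * v (.inl .V)) ^ 3 * Real.cos (v (.inl .β)) * Real.cos (v (.inl .γ))) := by
    rw [Matrix.det_fin_three]
    simp [partialDeriv, rateMap, rateVar, hYp, hYq, hYr, hZp, hZq, hZr, Function.update]
    linear_combination (-(A.m * v (.inl .V)) ^ 3 * Real.cos (v (.inl .β)) *
      Real.cos (v (.inl .γ))) * Real.sin_sq_add_cos_sq (v (.inl .α))
  rw [h]
  exact neg_ne_zero.2 (mul_ne_zero (mul_ne_zero (pow_ne_zero 3 (mul_ne_zero A.m_pos.ne' hV)) hβ) hγ)

theorem dependsOn_Q : DependsOn (fun v i => A.Q i v) flightVars := by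
  intro v v' h
  have hf := A.dependsOn_force h
  have hμ : v (.inl .μ) = v' (.inl .μ) := h _ (.inr ⟨2, rfl⟩)
  simp only [Prod.mk.injEq] at hf
  funext i
  fin_cases i <;> simp [Q, hf, hμ]

theorem _root_.Aircraft.dependsOn_pathMap : DependsOn pathMap (range pathVar) := by
  intro v v' h
  have hV : v (.inl .V) = v' (.inl .V) := h _ ⟨0, rfl⟩
  have hγ : v (.inl .γ) = v' (.inl .γ) := h _ ⟨1, rfl⟩
  have hχ : v (.inl .χ) = v' (.inl .χ) := h _ ⟨2, rfl⟩
  simp only [pathMap, hV, hγ, hχ]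

theorem dependsOn_rateMap : DependsOn A.rateMap (flightVars ∪ range rateVar) := by
  intro v v' h
  have hf := A.dependsOn_force fun c hc => h c (.inl hc)
  simp only [Prod.mk.injEq] at hf
  have hV : v (.inl .V) = v' (.inl .V) := h _ (.inl (.inl (.inr ⟨0, rfl⟩)))
  have hγ : v (.inl .γ) = v' (.inl .γ) := h _ (.inl (.inl (.inr ⟨1, rfl⟩)))
  have hα : v (.inl .α) = v' (.inl .α) := h _ (.inl (.inr ⟨0, rfl⟩))
  have hβ : v (.inl .β) = v' (.inl .β) := h _ (.inl (.inr ⟨1, rfl⟩))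
  have hμ : v (.inl .μ) = v' (.inl .μ) := h _ (.inl (.inr ⟨2, rfl⟩))
  have hp : v (.inl .p) = v' (.inl .p) := h _ (.inr ⟨0, rfl⟩)
  have hq : v (.inl .q) = v' (.inl .q) := h _ (.inr ⟨1, rfl⟩)
  have hr : v (.inl .r) = v' (.inl .r) := h _ (.inr ⟨2, rfl⟩)
  simp only [rateMap, hf, hV, hγ, hα, hβ, hμ, hp, hq, hr]

open ControlSystem in
theorem _root_.Aircraft.velocityDependsOn_pathRhs (ξ : Fin 4) :
    VelocityDependsOn pathRhs (range (outputVar ξ)) := by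
  intro v v' d d' _ hd
  simp only [pathRhs, hd .x ⟨0, rfl⟩, hd .y ⟨1, rfl⟩, hd .z ⟨2, rfl⟩]

theorem velocityDependsOn_forceRhs :
    ControlSystem.VelocityDependsOn A.forceRhs (range pathVar) := by
  intro v v' d d' hv hd
  simp only [forceRhs, hd .V ⟨0, rfl⟩, hd .γ ⟨1, rfl⟩, hd .χ ⟨2, rfl⟩, hv (.inl .V) ⟨0, rfl⟩,
    hv (.inl .γ) ⟨1, rfl⟩]

theorem velocityDependsOn_rateRhs : ControlSystem.VelocityDependsOn A.rateRhs flightVars := by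
  intro v v' d d' hv hd
  simp only [rateRhs, hd .α (.inr ⟨0, rfl⟩), hd .β (.inr ⟨1, rfl⟩), hd .μ (.inr ⟨2, rfl⟩),
    hv (.inl .V) (.inl (.inr ⟨0, rfl⟩)), hv (.inl .γ) (.inl (.inr ⟨1, rfl⟩)),
    hv (.inl .β) (.inr ⟨1, rfl⟩)]

theorem velocityDependsOn_torqueRhs :
    ControlSystem.VelocityDependsOn A.torqueRhs (range rateVar) := by
  intro v v' d d' hv hd
  simp only [torqueRhs, hd .p ⟨0, rfl⟩, hd .q ⟨1, rfl⟩, hd .r ⟨2, rfl⟩, hv (.inl .p) ⟨0, rfl⟩,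
    hv (.inl .q) ⟨1, rfl⟩, hv (.inl .r) ⟨2, rfl⟩]

theorem pathMap_eq (v : Point) : pathMap v = pathRhs v (A.rhs v) := rfl

/-- The force equations with denominators cleared. Both sides are then smooth everywhere, as
`exists_extend` requires; admissibility is needed only for the equivalence with the original
equations. -/
theorem Q_eq {v : Point} (hv : v ∈ admissible) : (fun i => A.Q i v) = A.forceRhs v (A.rhs v) := by
  obtain ⟨⟨hβ, hγ⟩, hV⟩ : (Real.cos (v (.inl .β)) ≠ 0 ∧ Real.cos (v (.inl .γ)) ≠ 0) ∧
      v (.inl .V) ≠ 0 := by simpa [admissible] using hv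
  have hm := A.m_pos.ne'
  funext i
  fin_cases i <;> simp [Q, forceRhs, rhs] <;> field_simp <;> ring

theorem rateMap_eq {v : Point} (hv : v ∈ admissible) : A.rateMap v = A.rateRhs v (A.rhs v) := by
  obtain ⟨⟨hβ, hγ⟩, hV⟩ : (Real.cos (v (.inl .β)) ≠ 0 ∧ Real.cos (v (.inl .γ)) ≠ 0) ∧
      v (.inl .V) ≠ 0 := by simpa [admissible] using hv
  have hm := A.m_pos.ne'
  funext i
  fin_cases i <;> simp [rateMap, rateRhs, rhs, Real.tan_eq_sin_div_cos] <;> field_simp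

theorem isUnit_det_J : IsUnit A.J.det := isUnit_iff_ne_zero.2 A.inertia_ne

/-- Applying `J` to the rotational equations cancels `J⁻¹` and isolates the torques. -/
theorem torque_eq (v : Point) : A.torque v = A.torqueRhs v (A.rhs v) := by
  have h : ![A.rhs v .p, A.rhs v .q, A.rhs v .r] = A.rotational v := by
    funext i
    fin_cases i <;> rfl
  rw [torqueRhs, h, rotational, Matrix.mulVec_mulVec, Matrix.mul_nonsing_inv _ A.isUnit_det_J,
    Matrix.one_mulVec, add_sub_cancel_left]

/-- The four systems of equations determine the derivatives of the states. -/
theorem eq_rhs_of_solves {v : Point} (hv : v ∈ admissible) {d : State → ℝ}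
    (h₁ : pathMap v = pathRhs v d) (h₂ : (fun i => A.Q i v) = A.forceRhs v d)
    (h₃ : A.rateMap v = A.rateRhs v d) (h₄ : A.torque v = A.torqueRhs v d) : d = A.rhs v := by
  obtain ⟨⟨hβ, hγ⟩, hV⟩ : (Real.cos (v (.inl .β)) ≠ 0 ∧ Real.cos (v (.inl .γ)) ≠ 0) ∧
      v (.inl .V) ≠ 0 := by simpa [admissible] using hv
  have hm := A.m_pos.ne'
  rw [A.pathMap_eq] at h₁
  rw [A.Q_eq hv] at h₂
  rw [A.rateMap_eq hv] at h₃
  rw [A.torque_eq, torqueRhs, torqueRhs, sub_left_inj] at h₄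
  have h₅ := Matrix.mulVec_injective_of_isUnit ((Matrix.isUnit_iff_isUnit_det _).2 A.isUnit_det_J) h₄
  funext s
  symm
  cases s with
  | x => exact congrFun h₁ 0
  | y => exact congrFun h₁ 1
  | z => exact congrFun h₁ 2
  | V => exact mul_left_cancel₀ hm (congrFun h₂ 0)
  | γ => exact mul_left_cancel₀ (mul_ne_zero hm hV) (neg_injective (congrFun h₂ 1))
  | χ =>
    exact mul_left_cancel₀ (mul_ne_zero (mul_ne_zero hγ hm) hV) (neg_injective (congrFun h₂ 2))
  | α => exact mul_left_cancel₀ (mul_ne_zero (mul_ne_zero hm hV) hβ) (congrFun h₃ 0)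
  | β => exact mul_left_cancel₀ (mul_ne_zero hm hV) (congrFun h₃ 1)
  | μ =>
    exact mul_left_cancel₀ (mul_ne_zero (mul_ne_zero (mul_ne_zero hm hV) hγ) hβ) (congrFun h₃ 2)
  | p => exact congrFun h₅ 0
  | q => exact congrFun h₅ 1
  | r => exact congrFun h₅ 2

end Model

end Aircraft

/-! ### Running the cascade and assembling the flat output -/

namespace Aircraft

/-- The functions on the jet space that recover the flat output itself. -/
theorem partialInverse_outputVar (A : Model) (ξ : Fin 4) {η : SystemCoord State Control → ℝ}
    (hη : η ∈ A.simplified.diffiety.carrier) :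
    PartialInverse (A.simplified.jetMap (outputVar ξ)) SystemCoord.values η (range (outputVar ξ))
      A.simplified.diffiety.carrier univ
      fun w => Function.extend (outputVar ξ) (fun j => w (some (j, 0))) (SystemCoord.values η) where
  isOpen_source := A.simplified.diffiety.isOpen_carrier
  isOpen_target := isOpen_univ
  mem_source := hη
  mapsTo := mapsTo_univ _ _
  smooth k := by
    by_cases hk : k ∈ range (outputVar ξ)
    · obtain ⟨j, rfl⟩ := hk
      simpa only [(outputVar_injective ξ).extend_apply] using SmoothFunOn.coord _
    · simpa only [Function.extend_apply' _ _ _ hk] using SmoothFunOn.const _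
  apply_eq := by
    rintro p - _ ⟨j, rfl⟩
    exact (outputVar_injective ξ).extend_apply _ _ _
  frozen w k hk := Function.extend_apply' _ _ _ hk

open ControlSystem in
theorem isRegularFlatOutputAt_outputs (A : Model) {η : SystemCoord State Control → ℝ}
    (hη : η ∈ A.simplified.diffiety.carrier)
    (hcontrol : (A.controlEffectiveness (SystemCoord.values η)).det ≠ 0) {ξ : Fin 4}
    (hξ : (A.DeltaMinor ξ (SystemCoord.values η)).det ≠ 0) :
    A.simplified.diffiety.IsRegularFlatOutputAt (Model.outputs ξ) η := by
  have hadm : ∀ p ∈ A.simplified.diffiety.carrier, SystemCoord.values p ∈ Model.admissible :=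
    fun p hp => hp.2
  have h0 := partialInverse_outputVar A ξ hη
  obtain ⟨O₁, hO₁, W₁, hW₁, g₁, h₁, hg₁, hs₁⟩ := exists_extend h0 subset_rfl contDiff_pathMap
    pathVar_injective (pathVar_notMem ξ) (det_pathMap (hadm η hη))
    (dependsOn_pathMap.mono subset_union_right) contDiff_pathRhs (velocityDependsOn_pathRhs ξ)
    fun p hp => A.pathMap_eq _
  have hforce := A.velocityDependsOn_forceRhs.mono (subset_union_right (s := range (outputVar ξ)))
  -- `hξ` is by unfolding the Jacobian condition for `A.Q` in the variables `attitudeVar ξ`;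
  -- `hcontrol` plays the same role for the torques in the fourth stage.
  obtain ⟨O₂, hO₂, W₂, hW₂, g₂, h₂, hg₂, hs₂⟩ := exists_extend h₁ hO₁ A.contDiff_Q
    (attitudeVar_injective ξ) (attitudeVar_notMem ξ) hξ
    (A.dependsOn_Q.mono (flightVars_subset ξ)) A.contDiff_forceRhs hforce
    fun p hp => A.Q_eq (hadm p hp)
  have hrate := A.velocityDependsOn_rateRhs.mono (flightVars_subset ξ)
  obtain ⟨O₃, hO₃, W₃, hW₃, g₃, h₃, hg₃, hs₃⟩ := exists_extend h₂ (hO₂.trans hO₁)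
    A.contDiff_rateMap rateVar_injective (rateVar_notMem ξ) (A.det_rateMap (hadm η hη))
    (A.dependsOn_rateMap.mono (union_subset_union_left _ (flightVars_subset ξ)))
    A.contDiff_rateRhs hrate fun p hp => A.rateMap_eq (hadm p hp)
  obtain ⟨O₄, hO₄, W₄, hW₄, g₄, h₄, hg₄, hs₄⟩ := exists_extend h₃ (hO₃.trans (hO₂.trans hO₁))
    A.contDiff_torque torqueVar_injective (torqueVar_notMem ξ) hcontrol
    (by rw [union_eq_univ]; exact fun v v' h => congrArg _ (funext fun k => h k (mem_univ k)))
    A.contDiff_torqueRhs (A.velocityDependsOn_torqueRhs.mono subset_union_right)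
    fun p hp => A.torque_eq _
  rw [union_eq_univ] at h₄
  -- Later stages leave the earlier variables unchanged, so the equations solved by `g₁`, `g₂`, `g₃`
  -- carry over to the final `g₄`.
  have hg₄₂ : ∀ w, ∀ k ∈ range (outputVar ξ) ∪ range pathVar ∪ range (attitudeVar ξ),
      g₄ w k = g₂ w k := fun w k hk => (hg₄ w k (.inl hk)).trans (hg₃ w k hk)
  have hg₄₁ : ∀ w, ∀ k ∈ range (outputVar ξ) ∪ range pathVar, g₄ w k = g₁ w k :=
    fun w k hk => (hg₄₂ w k (.inl hk)).trans (hg₂ w k hk)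
  refine isRegularFlatOutputAt_of_partialInverse (out := outputVar ξ) h₄
    (hO₄.trans (hO₃.trans (hO₂.trans hO₁))) (fun w hw hdom => ?_) fun w hw j => ?_
  · have hw₃ := hW₄ hw
    have hw₂ := hW₃ hw₃
    refine A.eq_rhs_of_solves hdom.2 ?_ ?_ ?_ (hs₄ w hw)
    · rw [dependsOn_pathMap fun k hk => hg₄₁ w k (.inr hk), hs₁ w (hW₂ hw₂)]
      exact ((velocityDependsOn_pathRhs ξ).apply_velocity
        (fun w k hk => hg₄₁ w k (.inl hk)) w).symm
    · refine (A.dependsOn_Q fun k hk => hg₄₂ w k (flightVars_subset ξ hk)).trans ?_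
      exact (hs₂ w hw₂).trans (hforce.apply_velocity
        (fun w k hk => hg₄₂ w k (.inl hk)) w).symm
    · rw [A.dependsOn_rateMap fun k hk => hg₄ w k
        (union_subset_union_left _ (flightVars_subset ξ) hk), hs₃ w hw₃]
      exact (hrate.apply_velocity (fun w k hk => hg₄ w k (.inl hk)) w).symm
  · rw [hg₄₁ w _ (.inl ⟨j, rfl⟩), hg₁ w _ ⟨j, rfl⟩]
    exact (outputVar_injective ξ).extend_apply _ _ _

end Aircraft

end

theorem mainTheorem5 (A : Aircraft.Model) (η : SystemCoord Aircraft.State Aircraft.Control → ℝ)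
    (hη : η ∈ A.simplified.diffiety.carrier)
    (hcontrol : (A.controlEffectiveness (SystemCoord.values η)).det ≠ 0) :
    ((A.Delta (SystemCoord.values η)).rank = 3 → A.simplified.diffiety.IsFlatPoint η) ∧
      ∀ ξ : Fin 4, (A.DeltaMinor ξ (SystemCoord.values η)).det ≠ 0 →
        A.simplified.diffiety.IsRegularFlatOutputAt (Aircraft.Model.outputs ξ) η := by
  have key : ∀ ξ : Fin 4, (A.DeltaMinor ξ (SystemCoord.values η)).det ≠ 0 →
      A.simplified.diffiety.IsRegularFlatOutputAt (Aircraft.Model.outputs ξ) η :=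
    fun ξ hξ => Aircraft.isRegularFlatOutputAt_outputs A hη hcontrol hξ
  refine ⟨fun hrank => ?_, key⟩
  obtain ⟨ξ, hξ⟩ := Matrix.exists_det_submatrix_succAbove_ne_zero hrank
  obtain ⟨O, φ, hφ, -⟩ := key ξ hξ
  exact ⟨4, O, φ, hφ⟩
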